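/- Let $\mathrm{Cob}$ be the category whose objects are finite disjoint unions of circles and whose morphisms are the homeomorphism classes (relative to the boundary) of compact orientable two-dimensional cobordisms, i.e. a cobordism is given by its connected components, their genera and the distribution of the boundary circles among them; composition is gluing. For a commutative ring $k$ let $\mathrm{Cob}_{/l}(k)$ be the category with the same objects, whose morphisms are the $k$-linear combinations of cobordisms modulo the local relations * 4TU: $C_{12}+C_{34}=C_{13}+C_{24}$, where $C$ is a cobordism with four disjoint discs $D_1,\dots,D_4$ on it (on arbitrary components) and $C_{ij}$ is obtained from $C$ by replacing $D_i\cup D_j$ by a tube; * S: a cobordism with a closed component of genus $0$ is zero; * T: a closed component of genus $1$ may be dropped and replaced by the factor $2$. For an object $\mathcal O$ let $\mathcal F_{\mathcal O}=\operatorname{Mor}(\mathcal O,-)$ be the tautological functor on $\mathrm{Cob}_{/l}(k)$, which acts on morphisms by composition. For a commutative ring $R$ and $h,t\in R$ let $A_{h,t}=R[X]/(X^2-hX-t)$, with the Frobenius algebra structure over $R$ given by $\Delta(1)=1\otimes X+X\otimes 1-h\,1\otimes 1$, $\Delta(X)=X\otimes X+t\,1\otimes 1$, $\varepsilon(1)=0$,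 $\varepsilon(X)=1$. Let $\mathcal F_H$ be the two-dimensional TQFT (the functor from $\mathrm{Cob}$ to $R$-modules that maps disjoint unions to tensor products) given by the Frobenius algebra $A_{H,0}=R[X]/(X^2-HX)$ over $R=\mathbb Z[H]$, and let $\mathcal F_T$ be the one given by $A_{0,T}=R[X]/(X^2-T)$ over $R=\mathbb Q[T]$. (1) Let $k=\mathbb Z$ and let $\mathbb Z[H]$ act on $\operatorname{Mor}(\bigcirc,\mathcal O')$ by letting $H$ add a handle to the component that contains the source circle. Then $\mathcal F_\bigcirc$, regarded as a functor to $\mathbb Z[H]$-modules, is the TQFT $\mathcal F_H$: the composite of $\mathcal F_\bigcirc$ with the projection $\mathrm{Cob}\to\mathrm{Cob}_{/l}(\mathbb Z)$ is naturally isomorphic to $\mathcal F_H$. (2) Let $k=\mathbb Q$ and let $\mathbb Q[T]$ act on $\operatorname{Mor}(\emptyset,\mathcal O')$ by letting $T$ be the renormalized 2-handle operator, i.e. one quarter of the 2-handle operator, where the 2-handle operator is the disjoint union with $\tfrac12\Sigma_3$, and $\Sigma_3$ is the closed surface of genus $3$. Then $\mathcal F_\emptyset$, regarded as a functor to $\mathbb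 Q[T]$-modules, is the TQFT $\mathcal F_T$: the composite of $\mathcal F_\emptyset$ with the projection $\mathrm{Cob}\to\mathrm{Cob}_{/l}(\mathbb Q)$ is naturally isomorphic to $\mathcal F_T$. -/

import Mathlib

open CategoryTheory
open scoped TensorProduct

noncomputable section

/-! ### Compact orientable surfaces with labelled boundary circles -/

/-- A compact orientable surface whose boundary circles are labelled by `B`, presented by its
connected components (numbered by `Fin n`), the genus of every component, and the component on
which each boundary circle lies. Components without boundary circles are closed surfaces. -/
abbrev SurfaceData (B : Type) : Type := Σ n : ℕ, (Fin n → ℕ) × (B → Fin n)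

/-- Two presentations describe surfaces that are homeomorphic relative to the boundary iff they
differ by a renumbering of the components. -/
def surfaceSetoid (B : Type) : Setoid (SurfaceData B) where
  r x y := ∃ e : Fin x.1 ≃ Fin y.1,
    (∀ k, y.2.1 (e k) = x.2.1 k) ∧ (∀ b, y.2.2 b = e (x.2.2 b))
  iseqv :=
    { refl := fun _ => ⟨Equiv.refl _, fun _ => rfl, fun _ => rfl⟩
      symm := by
        rintro x y ⟨e, h1, h2⟩
        exact ⟨e.symm, fun k => by rw [← h1]; simp, fun b => by rw [h2]; simp⟩
      trans := by
        rintro x y z ⟨e, h1, h2⟩ ⟨f, h3, h4⟩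
        exact ⟨e.trans f, fun k => by simp [h3, h1], fun b => by simp [h4, h2]⟩ }

/-- Homeomorphism classes, relative to the boundary, of compact orientable surfaces with boundary
circles labelled by `B`. -/
def Surface (B : Type) : Type := Quotient (surfaceSetoid B)

namespace Surface

/-- The surface with (finite) set of components `K`, genus function `g`, in which the boundary
circle `b` lies on the component `p b`. -/
def of {B K : Type} [Finite K] (g : K → ℕ) (p : B → K) : Surface B :=
  Quotient.mk (surfaceSetoid B)
    ⟨Nat.card K, g ∘ (Finite.equivFin K).symm, Finite.equivFin K ∘ p⟩

theorem of_eq_of {B K L : Type} [Finite K] [Finite L] {g : K → ℕ} {p : B → K} {g' : L → ℕ}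
    {p' : B → L} (e : K ≃ L) (hg : ∀ k, g' (e k) = g k) (hp : ∀ b, p' b = e (p b)) :
    of g p = of g' p' := by
  refine Quotient.sound ⟨(Finite.equivFin K).symm.trans (e.trans (Finite.equivFin L)), ?_, ?_⟩
  · intro k; simp [hg]
  · intro b; simp [hp]

theorem exists_of {B : Type} (C : Surface B) :
    ∃ (n : ℕ) (g : Fin n → ℕ) (p : B → Fin n), C = of g p := by
  obtain ⟨⟨n, g, p⟩, rfl⟩ := Quotient.exists_rep C
  refine ⟨n, g, p, Quotient.sound ⟨Finite.equivFin (Fin n), ?_, ?_⟩⟩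
  · intro k; simp
  · intro b; simp

/-! ### Attaching tubes -/

section Tubes

variable {B K E : Type}

/-- The components after attaching, for every `e : E`, a tube that joins a small disc on the
component `s e` to a small disc on the component `t e` (the two discs being removed). -/
abbrev TubeComp (s t : E → K) : Type := Quot fun a b => ∃ e, s e = a ∧ t e = b

/-- The genus of a component `q` after attaching tubes: if it arises from `v` old components joined
by `r` tubes, its genus is the sum of the old genera plus the number `r - (v - 1)` of independent
cycles of tubes. This is additivity of the Euler characteristic; by connectedness of `q` one always
has `v ≤ r + 1`, so that the subtraction is not truncated (`card_le_of_tube`). -/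
def tubeGenus (g : K → ℕ) (s t : E → K) (q : TubeComp s t) : ℕ :=
  (∑ᶠ k : {k : K // Quot.mk _ k = q}, g k) + Nat.card {e : E // Quot.mk _ (s e) = q} + 1
    - Nat.card {k : K // (Quot.mk _ k : TubeComp s t) = q}

/-- The surface obtained from the surface with components `K`, genera `g` and boundary circles
attached by `p`, by attaching a tube between `s e` and `t e` for each `e : E`. -/
def tubes [Finite K] (g : K → ℕ) (p : B → K) (s t : E → K) : Surface B :=
  of (tubeGenus g s t) fun b => (Quot.mk _ (p b) : TubeComp s t)

theorem card_le_of_tube [Finite E] (s t : E → K) (q : TubeComp s t) :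
    Nat.card {k : K // (Quot.mk _ k : TubeComp s t) = q}
      ≤ Nat.card {e : E // (Quot.mk _ (s e) : TubeComp s t) = q} + 1 := by
  let V := {k : K // (Quot.mk _ k : TubeComp s t) = q}
  let F := {e : E // (Quot.mk _ (s e) : TubeComp s t) = q}
  have hst : ∀ e, (Quot.mk _ (s e) : TubeComp s t) = Quot.mk _ (t e) :=
    fun e => Quot.sound ⟨e, rfl, rfl⟩
  let a : F → V := fun e => ⟨s e.1, e.2⟩
  let b : F → V := fun e => ⟨t e.1, (hst e.1).symm.trans e.2⟩
  let G : SimpleGraph V := SimpleGraph.fromRel fun x y => ∃ e, a e = x ∧ b e = y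
  have key : ∀ x y : K, Relation.EqvGen (fun x y => ∃ e, s e = x ∧ t e = y) x y →
      ∀ (hx : (Quot.mk _ x : TubeComp s t) = q) (hy : (Quot.mk _ y : TubeComp s t) = q),
        G.Reachable ⟨x, hx⟩ ⟨y, hy⟩ := by
    intro x y h
    induction h with
    | rel x y h =>
      intro hx hy
      obtain ⟨e, rfl, rfl⟩ := h
      by_cases hne : (⟨s e, hx⟩ : V) = ⟨t e, hy⟩
      · rw [hne]
      · exact SimpleGraph.Adj.reachable
          ((SimpleGraph.fromRel_adj _ _ _).2 ⟨hne, Or.inl ⟨⟨e, hx⟩, rfl, rfl⟩⟩)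
    | refl x => intro hx hy; exact SimpleGraph.Reachable.refl _
    | symm x y _ ih => intro hx hy; exact (ih hy hx).symm
    | trans x y z h1 _ ih1 ih2 =>
      intro hx hz
      have hy : (Quot.mk _ y : TubeComp s t) = q := (Quot.eqvGen_sound h1).symm.trans hx
      exact (ih1 hx hy).trans (ih2 hy hz)
  have hconn : G.Connected := by
    have : Nonempty V := by
      obtain ⟨k, rfl⟩ := Quot.exists_rep q
      exact ⟨⟨k, rfl⟩⟩
    refine SimpleGraph.Connected.mk ?_
    rintro ⟨x, hx⟩ ⟨y, hy⟩
    exact key x y (Quot.eqvGen_exact (hx.trans hy.symm)) hx hy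
  refine hconn.card_vert_le_card_edgeSet_add_one.trans (Nat.add_le_add_right ?_ 1)
  have hedge : ∀ z : G.edgeSet, ∃ e : F, s(a e, b e) = z.1 := by
    rintro ⟨z, hz⟩
    induction z using Sym2.ind with
    | _ x y =>
      have hxy : G.Adj x y := hz
      obtain ⟨_, ⟨e, rfl, rfl⟩ | ⟨e, rfl, rfl⟩⟩ := (SimpleGraph.fromRel_adj _ x y).1 hxy
      · exact ⟨e, rfl⟩
      · exact ⟨e, Sym2.eq_swap⟩
  choose f hf using hedge
  exact Nat.card_le_card_of_injective f fun z w h =>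
    Subtype.ext (by rw [← hf z, ← hf w, h])

/-- The genera after attaching tubes, tested against an arbitrary function of the component. -/
theorem tubeGenus_sum [Fintype K] [Fintype E] (g : K → ℕ) (s t : E → K)
    [Fintype (TubeComp s t)] (φ : TubeComp s t → ℤ) :
    ∑ q, φ q * ((tubeGenus g s t q : ℤ) - 1)
      = ∑ k, φ (Quot.mk _ k) * ((g k : ℤ) - 1) + ∑ e, φ (Quot.mk _ (s e)) := by
  classical
  have hcast : ∀ q, (tubeGenus g s t q : ℤ) - 1
      = (∑ k : {k : K // (Quot.mk _ k : TubeComp s t) = q}, ((g k : ℤ) - 1))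
        + Nat.card {e : E // (Quot.mk _ (s e) : TubeComp s t) = q} := by
    intro q
    have h := card_le_of_tube s t q
    rw [tubeGenus, finsum_eq_sum_of_fintype, Nat.cast_sub (by lia), Finset.sum_sub_distrib]
    simp only [Finset.sum_const, Finset.card_univ, Nat.card_eq_fintype_card]
    push_cast
    ring
  simp_rw [hcast, mul_add, Finset.sum_add_distrib]
  congr 1
  · rw [← Fintype.sum_fiberwise (fun k : K => (Quot.mk _ k : TubeComp s t))]
    refine Finset.sum_congr rfl fun q _ => ?_
    rw [Finset.mul_sum]
    refine Finset.sum_congr rfl fun k _ => ?_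
    rw [k.2]
  · rw [← Fintype.sum_fiberwise (fun e : E => (Quot.mk _ (s e) : TubeComp s t))]
    refine Finset.sum_congr rfl fun q _ => ?_
    rw [Finset.sum_congr rfl fun e _ => by rw [e.2]]
    simp [Nat.card_eq_fintype_card, mul_comm]

/-- Recognition of the result of attaching tubes. -/
theorem of_eq_tubes {L : Type} [Fintype K] [Fintype E] [Fintype L] {g : K → ℕ} {p : B → K}
    {s t : E → K} {g' : L → ℕ} {p' : B → L} (π : K → L) (ρ : L → TubeComp s t)
    (hπ : Function.Surjective π) (hst : ∀ e, π (s e) = π (t e))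
    (hρ : ∀ k, ρ (π k) = Quot.mk _ k) (hp : ∀ b, p' b = π (p b))
    (hg : ∀ φ : L → ℤ, ∑ l, φ l * ((g' l : ℤ) - 1)
      = ∑ k, φ (π k) * ((g k : ℤ) - 1) + ∑ e, φ (π (s e))) :
    of g' p' = tubes g p s t := by
  classical
  have : Fintype (TubeComp s t) := Fintype.ofFinite _
  let e : TubeComp s t ≃ L :=
    { toFun := Quot.lift π (by rintro _ _ ⟨e, rfl, rfl⟩; exact hst e)
      invFun := ρ
      left_inv := by rintro ⟨k⟩; exact hρ k
      right_inv := by intro l; obtain ⟨k, rfl⟩ := hπ l; rw [hρ] }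
  symm
  refine of_eq_of e ?_ ?_
  · intro q
    have h1 := tubeGenus_sum g s t (Pi.single q 1)
    have h2 := hg (Pi.single (e q) 1)
    have h3 : ∀ k, (Pi.single (e q) 1 : L → ℤ) (π k)
        = (Pi.single q 1 : TubeComp s t → ℤ) (Quot.mk _ k) := by
      intro k
      have : π k = e (Quot.mk _ k) := rfl
      rw [this]
      simp [Pi.single_apply]
    simp_rw [h3] at h2
    rw [← h1] at h2
    simp [Pi.single_apply] at h2
    exact h2
  · intro b; exact hp b

end Tubes
/-- Relabelling the components and the tubes. -/
theorem tubes_congr {B K E K' E' : Type} [Finite K] [Finite K'] [Finite E] [Finite E']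
    {g : K → ℕ} {p : B → K} {s t : E → K} {g' : K' → ℕ} {p' : B → K'} {s' t' : E' → K'}
    (α : K ≃ K') (ε : E ≃ E') (hg : ∀ k, g' (α k) = g k) (hp : ∀ b, p' b = α (p b))
    (hs : ∀ e, s' (ε e) = α (s e)) (ht : ∀ e, t' (ε e) = α (t e)) :
    tubes g p s t = tubes g' p' s' t' := by
  have := Fintype.ofFinite K
  have := Fintype.ofFinite K'
  have := Fintype.ofFinite E
  have := Fintype.ofFinite E'
  have := Fintype.ofFinite (TubeComp s t)
  refine of_eq_tubes (fun k => Quot.mk _ (α.symm k))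
    (Quot.lift (fun k => Quot.mk _ (α k)) ?_) ?_ ?_ ?_ ?_ ?_
  · rintro _ _ ⟨e, rfl, rfl⟩
    exact Quot.sound ⟨ε e, hs e, ht e⟩
  · rintro ⟨k⟩
    exact ⟨α k, by simp⟩
  · intro e
    obtain ⟨e, rfl⟩ := ε.surjective e
    rw [hs, ht, α.symm_apply_apply, α.symm_apply_apply]
    exact Quot.sound ⟨e, rfl, rfl⟩
  · intro k; simp
  · intro b; simp [hp]
  · intro φ
    rw [tubeGenus_sum, ← α.sum_comp, ← ε.sum_comp]
    simp [hg, hs]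

/-- Attaching tubes in two steps, the first ones between components of a part `K` of the
surface. -/
theorem tubes_tubes_inl {B K L E F : Type} [Finite K] [Finite L] [Finite E] [Finite F]
    (g : K → ℕ) (g' : L → ℕ) (s t : E → K) (p : B → K ⊕ L) (u v : F → K ⊕ L) :
    tubes (Sum.elim (tubeGenus g s t) g') (fun b => Sum.map (Quot.mk _) id (p b))
        (fun f => Sum.map (Quot.mk _) id (u f)) (fun f => Sum.map (Quot.mk _) id (v f))
      = tubes (Sum.elim g g') p (Sum.elim (fun e => Sum.inl (s e)) u)
          (Sum.elim (fun e => Sum.inl (t e)) v) := by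
  have := Fintype.ofFinite K
  have := Fintype.ofFinite L
  have := Fintype.ofFinite E
  have := Fintype.ofFinite F
  have := Fintype.ofFinite (TubeComp s t)
  let u' : F → TubeComp s t ⊕ L := fun f => Sum.map (Quot.mk _) id (u f)
  let v' : F → TubeComp s t ⊕ L := fun f => Sum.map (Quot.mk _) id (v f)
  have := Fintype.ofFinite (TubeComp u' v')
  let s'' : E ⊕ F → K ⊕ L := Sum.elim (fun e => Sum.inl (s e)) u
  let t'' : E ⊕ F → K ⊕ L := Sum.elim (fun e => Sum.inl (t e)) v
  let ρ : TubeComp s t ⊕ L → TubeComp s'' t'' :=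
    Sum.elim (Quot.lift (fun k => Quot.mk _ (Sum.inl k))
      (by rintro _ _ ⟨e, rfl, rfl⟩; exact Quot.sound ⟨Sum.inl e, rfl, rfl⟩))
      (fun l => Quot.mk _ (Sum.inr l))
  have hρ : ∀ x : K ⊕ L, ρ (Sum.map (Quot.mk _) id x) = Quot.mk _ x := by
    rintro (k | l) <;> rfl
  refine of_eq_tubes (fun x => (Quot.mk _ (Sum.map (Quot.mk _) id x) : TubeComp u' v'))
    (Quot.lift ρ ?_) ?_ ?_ ?_ ?_ ?_
  · rintro _ _ ⟨f, rfl, rfl⟩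
    rw [hρ, hρ]
    exact Quot.sound ⟨Sum.inr f, rfl, rfl⟩
  · rintro ⟨q | l⟩
    · obtain ⟨k, rfl⟩ := Quot.exists_rep q
      exact ⟨Sum.inl k, rfl⟩
    · exact ⟨Sum.inr l, rfl⟩
  · rintro (e | f)
    · have h : (Quot.mk _ (s e) : TubeComp s t) = Quot.mk _ (t e) := Quot.sound ⟨e, rfl, rfl⟩
      simp [h]
    · exact Quot.sound ⟨f, rfl, rfl⟩
  · intro k; exact hρ k
  · intro b; rfl
  · intro φ
    rw [tubeGenus_sum]
    simp only [Fintype.sum_sum_type, Sum.elim_inl, Sum.elim_inr, Sum.map_inl, Sum.map_inr, id]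
    rw [tubeGenus_sum g s t (fun q => φ (Quot.mk _ (Sum.inl q)))]
    ring

/-! ### Disjoint union and gluing -/

/-- The disjoint union of a cobordism from `S` to `T` and a cobordism from `S'` to `T'`. -/
def disj {S T S' T' : Type} (C : Surface (S ⊕ T)) (D : Surface (S' ⊕ T')) :
    Surface ((S ⊕ S') ⊕ (T ⊕ T')) :=
  Quotient.liftOn₂ C D
    (fun x y => of (Sum.elim x.2.1 y.2.1)
      (Sum.elim (Sum.map (x.2.2 ∘ Sum.inl) (y.2.2 ∘ Sum.inl))
        (Sum.map (x.2.2 ∘ Sum.inr) (y.2.2 ∘ Sum.inr))))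
    (by
      rintro x y x' y' ⟨α, h1, h2⟩ ⟨β, h3, h4⟩
      refine of_eq_of (Equiv.sumCongr α β) ?_ ?_
      · rintro (k | k) <;> simp [h1, h3]
      · rintro ((b | b) | (b | b)) <;> simp [h2, h4])

/-- The composite of a cobordism `C` from `S` to `T` and a cobordism `D` from `T` to `U`, obtained
by gluing them along the circles `T`. Gluing two surfaces along a boundary circle amounts to
attaching a tube between the components that contain it, once the circle is capped off by discs. -/
def comp {S T U : Type} [Finite T] (C : Surface (S ⊕ T)) (D : Surface (T ⊕ U)) :
    Surface (S ⊕ U) :=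
  Quotient.liftOn₂ C D
    (fun x y => tubes (Sum.elim x.2.1 y.2.1) (Sum.map (x.2.2 ∘ Sum.inl) (y.2.2 ∘ Sum.inr))
      (fun b : T => Sum.inl (x.2.2 (Sum.inr b))) (fun b : T => Sum.inr (y.2.2 (Sum.inl b))))
    (by
      rintro x y x' y' ⟨α, h1, h2⟩ ⟨β, h3, h4⟩
      refine tubes_congr (Equiv.sumCongr α β) (Equiv.refl T) ?_ ?_ ?_ ?_
      · rintro (k | k) <;> simp [h1, h3]
      · rintro (b | b) <;> simp [h2, h4]
      · intro b; simp [h2]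
      · intro b; simp [h4])

section Comp

variable {S T U K L E : Type} [Finite T] [Finite K] [Finite L] [Finite E]

theorem comp_of (g : K → ℕ) (p : S ⊕ T → K) (g' : L → ℕ) (p' : T ⊕ U → L) :
    comp (of g p) (of g' p')
      = tubes (Sum.elim g g') (Sum.map (p ∘ Sum.inl) (p' ∘ Sum.inr))
          (fun b : T => Sum.inl (p (Sum.inr b))) (fun b : T => Sum.inr (p' (Sum.inl b))) := by
  symm
  refine tubes_congr (Equiv.sumCongr (Finite.equivFin K) (Finite.equivFin L)) (Equiv.refl T)
    ?_ ?_ ?_ ?_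
  · rintro (k | k) <;> simp
  · rintro (b | b) <;> simp
  · intro b; simp
  · intro b; simp

theorem comp_tubes_left (g : K → ℕ) (p : S ⊕ T → K) (s t : E → K) (g' : L → ℕ)
    (p' : T ⊕ U → L) :
    comp (tubes g p s t) (of g' p')
      = tubes (Sum.elim g g') (Sum.map (p ∘ Sum.inl) (p' ∘ Sum.inr))
          (Sum.elim (fun e => Sum.inl (s e)) fun b : T => Sum.inl (p (Sum.inr b)))
          (Sum.elim (fun e => Sum.inl (t e)) fun b : T => Sum.inr (p' (Sum.inl b))) := by
  rw [← tubes_tubes_inl, tubes, comp_of]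
  refine tubes_congr (Equiv.refl _) (Equiv.refl T) (fun _ => rfl) ?_ (fun _ => rfl) (fun _ => rfl)
  rintro (b | b) <;> rfl

theorem comp_tubes_right (g : K → ℕ) (p : T ⊕ U → K) (s t : E → K) (g' : L → ℕ)
    (p' : S ⊕ T → L) :
    comp (of g' p') (tubes g p s t)
      = tubes (Sum.elim g' g) (Sum.map (p' ∘ Sum.inl) (p ∘ Sum.inr))
          (Sum.elim (fun e => Sum.inr (s e)) fun b : T => Sum.inl (p' (Sum.inr b)))
          (Sum.elim (fun e => Sum.inr (t e)) fun b : T => Sum.inr (p (Sum.inl b))) := by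
  rw [tubes, comp_of]
  trans tubes (Sum.elim g g') (fun b => (Sum.map (p' ∘ Sum.inl) (p ∘ Sum.inr) b).swap)
    (Sum.elim (fun e => Sum.inl (s e)) fun b : T => Sum.inr (p' (Sum.inr b)))
    (Sum.elim (fun e => Sum.inl (t e)) fun b : T => Sum.inl (p (Sum.inl b)))
  · rw [← tubes_tubes_inl]
    refine tubes_congr (Equiv.sumComm _ _) (Equiv.refl T) ?_ ?_ (fun _ => rfl) (fun _ => rfl)
    · rintro (k | k) <;> rfl
    · rintro (b | b) <;> rfl
  · refine tubes_congr (Equiv.sumComm _ _) (Equiv.refl _) ?_ ?_ ?_ ?_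
    · rintro (k | k) <;> rfl
    · rintro (b | b) <;> rfl
    · rintro (b | b) <;> rfl
    · rintro (b | b) <;> rfl

theorem comp_assoc {V : Type} [Finite U] (C : Surface (S ⊕ T)) (D : Surface (T ⊕ U))
    (F : Surface (U ⊕ V)) : comp (comp C D) F = comp C (comp D F) := by
  obtain ⟨_, g, p, rfl⟩ := C.exists_of
  obtain ⟨_, g', p', rfl⟩ := D.exists_of
  obtain ⟨_, g'', p'', rfl⟩ := F.exists_of
  rw [comp_of, comp_of, comp_tubes_left, comp_tubes_right]
  refine tubes_congr (Equiv.sumAssoc _ _ _) (Equiv.sumComm _ _) ?_ ?_ ?_ ?_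
  · rintro ((k | k) | k) <;> rfl
  · rintro (b | b) <;> rfl
  · rintro (b | b) <;> rfl
  · rintro (b | b) <;> rfl

/-- The union of cylinders that joins, for a bijection `e : S ≃ T`, the circle `b` of the source
to the circle `e b` of the target. -/
def cyl {S T : Type} [Finite S] (e : S ≃ T) : Surface (S ⊕ T) :=
  of (fun _ : S => 0) (Sum.elim id e.symm)

theorem cyl_comp (C : Surface (T ⊕ U)) : comp (cyl (Equiv.refl T)) C = C := by
  obtain ⟨_, g, p, rfl⟩ := C.exists_of
  have := Fintype.ofFinite T
  rw [cyl, comp_of]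
  symm
  refine of_eq_tubes (Sum.elim (fun b => p (Sum.inl b)) id) (fun k => Quot.mk _ (Sum.inr k))
    ?_ ?_ ?_ ?_ ?_
  · intro k; exact ⟨Sum.inr k, rfl⟩
  · intro b; rfl
  · rintro (b | k)
    · exact (Quot.sound ⟨b, rfl, rfl⟩ : _ = _).symm
    · rfl
  · rintro (b | b) <;> rfl
  · intro φ
    simp [Fintype.sum_sum_type]

theorem comp_cyl (C : Surface (S ⊕ T)) : comp C (cyl (Equiv.refl T)) = C := by
  obtain ⟨_, g, p, rfl⟩ := C.exists_of
  have := Fintype.ofFinite T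
  rw [cyl, comp_of]
  symm
  refine of_eq_tubes (Sum.elim id (fun b => p (Sum.inr b))) (fun k => Quot.mk _ (Sum.inl k))
    ?_ ?_ ?_ ?_ ?_
  · intro k; exact ⟨Sum.inl k, rfl⟩
  · intro b; rfl
  · rintro (k | b)
    · rfl
    · exact Quot.sound ⟨b, rfl, rfl⟩
  · rintro (b | b) <;> rfl
  · intro φ
    simp [Fintype.sum_sum_type]

end Comp

/-! ### The local relations -/

/-- The surface given by `g` and `p`, together with an additional closed component of genus `c`. -/
def addClosed {B K : Type} [Finite K] (g : K → ℕ) (p : B → K) (c : ℕ) : Surface B :=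
  of (Sum.elim g fun _ : Unit => c) fun b => Sum.inl (p b)

/-- The surface given by `g` and `p`, with a tube between a disc on the component `i` and a disc
on the component `j` (which may be equal: then a handle is added). -/
def addTube {B K : Type} [Finite K] (g : K → ℕ) (p : B → K) (i j : K) : Surface B :=
  tubes g p (fun _ : Unit => i) fun _ : Unit => j

/-- The local relations among formal linear combinations of surfaces with boundary `B`:
* 4TU: `C₁₂ + C₃₄ = C₁₃ + C₂₄` for four disjoint discs on a surface `C` (here numbered from `0`),
  lying on the arbitrary components `D 0`, `D 1`, `D 2`, `D 3`, where `Cᵢⱼ` is `C` with the `i`-th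
  and the `j`-th disc replaced by a tube;
* S: a surface with a closed component of genus `0` vanishes;
* T: a closed component of genus `1` may be replaced by the factor `2`. -/
inductive IsLocalRel (k : Type) [CommRing k] {B : Type} : (Surface B →₀ k) → Prop
  | fourTu {K : Type} [Finite K] (g : K → ℕ) (p : B → K) (D : Fin 4 → K) :
      IsLocalRel k
        (Finsupp.single (addTube g p (D 0) (D 1)) 1 + Finsupp.single (addTube g p (D 2) (D 3)) 1
          - Finsupp.single (addTube g p (D 0) (D 2)) 1
          - Finsupp.single (addTube g p (D 1) (D 3)) 1)
  | sphere {K : Type} [Finite K] (g : K → ℕ) (p : B → K) :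
      IsLocalRel k (Finsupp.single (addClosed g p 0) 1)
  | torus {K : Type} [Finite K] (g : K → ℕ) (p : B → K) :
      IsLocalRel k (Finsupp.single (addClosed g p 1) 1 - Finsupp.single (of g p) 2)

theorem tubes_tubes {B K E F : Type} [Finite K] [Finite E] [Finite F]
    (g : K → ℕ) (s t : E → K) (p : B → K) (u v : F → K) :
    tubes (tubeGenus g s t) (fun b => Quot.mk _ (p b)) (fun f => Quot.mk _ (u f))
        (fun f => Quot.mk _ (v f))
      = tubes g p (Sum.elim s u) (Sum.elim t v) := by
  trans tubes (Sum.elim g (Empty.elim : Empty → ℕ)) (fun b => Sum.inl (p b))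
    (Sum.elim (fun e => Sum.inl (s e)) fun f => Sum.inl (u f))
    (Sum.elim (fun e => Sum.inl (t e)) fun f => Sum.inl (v f))
  · rw [← tubes_tubes_inl]
    exact tubes_congr (Equiv.sumEmpty _ _).symm (Equiv.refl _) (fun _ => rfl) (fun _ => rfl)
      (fun _ => rfl) (fun _ => rfl)
  · refine tubes_congr (Equiv.sumEmpty _ _) (Equiv.refl _) ?_ (fun _ => rfl) ?_ ?_
    · rintro (k | k)
      · rfl
      · exact k.elim
    · rintro (e | e) <;> rfl
    · rintro (e | e) <;> rfl

theorem tubes_addClosed {B K E : Type} [Finite K] [Finite E] (g : K → ℕ) (p : B → K)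
    (s t : E → K) (c : ℕ) :
    addClosed (tubeGenus g s t) (fun b => (Quot.mk _ (p b) : TubeComp s t)) c
      = tubes (Sum.elim g fun _ : Unit => c) (fun b => Sum.inl (p b)) (fun e => Sum.inl (s e))
          (fun e => Sum.inl (t e)) := by
  have := Fintype.ofFinite K
  have := Fintype.ofFinite E
  have := Fintype.ofFinite (TubeComp s t)
  refine of_eq_tubes (Sum.map (Quot.mk _) id)
    (Sum.elim (Quot.lift (fun k => Quot.mk _ (Sum.inl k)) ?_) fun l => Quot.mk _ (Sum.inr l))
    ?_ ?_ ?_ (fun _ => rfl) ?_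
  · rintro _ _ ⟨e, rfl, rfl⟩
    exact Quot.sound ⟨e, rfl, rfl⟩
  · rintro (q | l)
    · obtain ⟨k, rfl⟩ := Quot.exists_rep q
      exact ⟨Sum.inl k, rfl⟩
    · exact ⟨Sum.inr l, rfl⟩
  · intro e
    exact congrArg Sum.inl (Quot.sound ⟨e, rfl, rfl⟩)
  · rintro (k | l) <;> rfl
  · intro φ
    simp only [Fintype.sum_sum_type, Sum.elim_inl, Sum.elim_inr, Sum.map_inl, Sum.map_inr, id]
    rw [tubeGenus_sum g s t (fun q => φ (Sum.inl q))]
    ring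

section LocalRel

variable {S T U : Type} [Finite T]

variable {K L : Type} [Finite K] [Finite L]

theorem comp_addTube (g : K → ℕ) (p : S ⊕ T → K) (i j : K) (g' : L → ℕ) (p' : T ⊕ U → L) :
    comp (addTube g p i j) (of g' p')
      = addTube (tubeGenus (Sum.elim g g') (fun b : T => Sum.inl (p (Sum.inr b)))
            (fun b : T => Sum.inr (p' (Sum.inl b))))
          (fun b => Quot.mk _ (Sum.map (p ∘ Sum.inl) (p' ∘ Sum.inr) b))
          (Quot.mk _ (Sum.inl i)) (Quot.mk _ (Sum.inl j)) := by
  rw [addTube, addTube, comp_tubes_left, tubes_tubes (u := fun _ : Unit => Sum.inl i)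
    (v := fun _ : Unit => Sum.inl j)]
  refine tubes_congr (Equiv.refl _) (Equiv.sumComm _ _) (fun _ => rfl) (fun _ => rfl) ?_ ?_
  · rintro (e | e) <;> rfl
  · rintro (e | e) <;> rfl

theorem comp_addTube' (g : K → ℕ) (p : S ⊕ T → K) (g' : L → ℕ) (p' : T ⊕ U → L) (i j : L) :
    comp (of g p) (addTube g' p' i j)
      = addTube (tubeGenus (Sum.elim g g') (fun b : T => Sum.inl (p (Sum.inr b)))
            (fun b : T => Sum.inr (p' (Sum.inl b))))
          (fun b => Quot.mk _ (Sum.map (p ∘ Sum.inl) (p' ∘ Sum.inr) b))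
          (Quot.mk _ (Sum.inr i)) (Quot.mk _ (Sum.inr j)) := by
  rw [addTube, addTube, comp_tubes_right, tubes_tubes (u := fun _ : Unit => Sum.inr i)
    (v := fun _ : Unit => Sum.inr j)]
  refine tubes_congr (Equiv.refl _) (Equiv.sumComm _ _) (fun _ => rfl) (fun _ => rfl) ?_ ?_
  · rintro (e | e) <;> rfl
  · rintro (e | e) <;> rfl

theorem comp_addClosed (g : K → ℕ) (p : S ⊕ T → K) (c : ℕ) (g' : L → ℕ) (p' : T ⊕ U → L) :
    comp (addClosed g p c) (of g' p')
      = addClosed (tubeGenus (Sum.elim g g') (fun b : T => Sum.inl (p (Sum.inr b)))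
            (fun b : T => Sum.inr (p' (Sum.inl b))))
          (fun b => Quot.mk _ (Sum.map (p ∘ Sum.inl) (p' ∘ Sum.inr) b)) c := by
  rw [tubes_addClosed, addClosed, comp_of]
  refine tubes_congr ((Equiv.sumAssoc _ _ _).trans (((Equiv.refl _).sumCongr
    (Equiv.sumComm _ _)).trans (Equiv.sumAssoc _ _ _).symm)) (Equiv.refl _) ?_ ?_
    (fun _ => rfl) (fun _ => rfl)
  · rintro ((k | k) | k) <;> rfl
  · rintro (b | b) <;> rfl

theorem comp_addClosed' (g : K → ℕ) (p : S ⊕ T → K) (c : ℕ) (g' : L → ℕ) (p' : T ⊕ U → L) :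
    comp (of g p) (addClosed g' p' c)
      = addClosed (tubeGenus (Sum.elim g g') (fun b : T => Sum.inl (p (Sum.inr b)))
            (fun b : T => Sum.inr (p' (Sum.inl b))))
          (fun b => Quot.mk _ (Sum.map (p ∘ Sum.inl) (p' ∘ Sum.inr) b)) c := by
  rw [tubes_addClosed, addClosed, comp_of]
  refine tubes_congr (Equiv.sumAssoc _ _ _).symm (Equiv.refl _) ?_ ?_
    (fun _ => rfl) (fun _ => rfl)
  · rintro (k | k | k) <;> rfl
  · rintro (b | b) <;> rfl

theorem IsLocalRel.comp_right {k : Type} [CommRing k] {f : Surface (S ⊕ T) →₀ k}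
    (h : IsLocalRel k f) (C : Surface (T ⊕ U)) :
    IsLocalRel k (f.mapDomain fun F => comp F C) := by
  obtain ⟨_, g', p', rfl⟩ := C.exists_of
  cases h with
  | fourTu g p D =>
    simpa only [sub_eq_add_neg, ← Finsupp.single_neg, Finsupp.mapDomain_add,
      Finsupp.mapDomain_single, comp_addTube] using
      IsLocalRel.fourTu (k := k) _ _ fun i => Quot.mk _ (Sum.inl (D i))
  | sphere g p =>
    rw [Finsupp.mapDomain_single, comp_addClosed]
    exact .sphere _ _
  | torus g p =>
    simpa only [sub_eq_add_neg, ← Finsupp.single_neg, Finsupp.mapDomain_add,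
      Finsupp.mapDomain_single, comp_addClosed, comp_of, tubes] using
      IsLocalRel.torus (k := k) (B := S ⊕ U) _ _

theorem IsLocalRel.comp_left {k : Type} [CommRing k] {f : Surface (T ⊕ U) →₀ k}
    (h : IsLocalRel k f) (C : Surface (S ⊕ T)) :
    IsLocalRel k (f.mapDomain fun F => comp C F) := by
  obtain ⟨_, g', p', rfl⟩ := C.exists_of
  cases h with
  | fourTu g p D =>
    simpa only [sub_eq_add_neg, ← Finsupp.single_neg, Finsupp.mapDomain_add,
      Finsupp.mapDomain_single, comp_addTube'] using
      IsLocalRel.fourTu (k := k) _ _ fun i => Quot.mk _ (Sum.inr (D i))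
  | sphere g p =>
    rw [Finsupp.mapDomain_single, comp_addClosed']
    exact .sphere _ _
  | torus g p =>
    simpa only [sub_eq_add_neg, ← Finsupp.single_neg, Finsupp.mapDomain_add,
      Finsupp.mapDomain_single, comp_addClosed', comp_of, tubes] using
      IsLocalRel.torus (k := k) (B := S ⊕ U) _ _

/-- The linear combinations of surfaces that vanish modulo the local relations. -/
def localRel (k : Type) [CommRing k] (B : Type) : Submodule k (Surface B →₀ k) :=
  Submodule.span k {f | IsLocalRel k f}

end LocalRel

/-- The connected surface of genus `g` with boundary circles `B`. -/
def connected (B : Type) (g : ℕ) : Surface B := of (fun _ : Unit => g) fun _ => ()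

end Surface

/-! ### The cobordism category -/

/-- An object of the category of two-dimensional cobordisms: a disjoint union of finitely many
(oriented) circles, indexed by `carrier`. Up to homeomorphism relative to the boundary, an oriented
cobordism is determined by its components, their genera, and the distribution of the boundary
circles among the components. -/
structure Cob where
  carrier : Type
  [finite : Finite carrier]

namespace Cob

attribute [instance] Cob.finite

instance : CoeSort Cob Type := ⟨Cob.carrier⟩

/-- A cobordism from `S` to `T` is a surface with boundary `S ⊕ T`; composition is gluing. -/
instance : Category Cob where
  Hom S T := Surface (S ⊕ T)
  id S := Surface.cyl (Equiv.refl S)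
  comp C D := Surface.comp C D
  id_comp C := Surface.cyl_comp C
  comp_id C := Surface.comp_cyl C
  assoc C D F := Surface.comp_assoc C D F

/-- The empty object. -/
def empty : Cob := ⟨Empty⟩

/-- One circle. -/
def circle : Cob := ⟨Unit⟩

instance : IsEmpty empty := inferInstanceAs (IsEmpty Empty)

instance : Unique circle := inferInstanceAs (Unique Unit)

/-- Disjoint union of objects. -/
def union (S T : Cob) : Cob := ⟨S ⊕ T⟩

/-- Disjoint union of cobordisms. -/
def unionHom {S T S' T' : Cob} (C : S ⟶ T) (D : S' ⟶ T') : S.union S' ⟶ T.union T' :=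
  Surface.disj C D

/-- The cylinders along a bijection of the sets of circles. -/
def cyl {S T : Cob} (e : S ≃ T) : S ⟶ T := Surface.cyl e

/-- The connected cobordism of genus `g` from `S` to `T`. -/
def connected (S T : Cob) (g : ℕ) : S ⟶ T := Surface.connected (S ⊕ T) g

end Cob

/-! ### Cobordisms modulo the local relations -/

namespace Surface

/-- Formal `k`-linear combinations of surfaces with boundary `B`, modulo the local relations. -/
abbrev ModRel (k : Type) [CommRing k] (B : Type) : Type := (Surface B →₀ k) ⧸ localRel k B

variable (k : Type) [CommRing k]

/-- The class of a surface modulo the local relations. -/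
def toModRel {B : Type} (C : Surface B) : ModRel k B :=
  Submodule.Quotient.mk (Finsupp.single C 1)

variable {k}

theorem modRel_induction {B : Type} {P : ModRel k B → Prop} (x : ModRel k B)
    (of : ∀ C : Surface B, P (toModRel k C)) (add : ∀ x y, P x → P y → P (x + y))
    (smul : ∀ (r : k) x, P x → P (r • x)) (zero : P 0) : P x := by
  induction x using Submodule.Quotient.induction_on with
  | _ f =>
    induction f using Finsupp.induction_linear with
    | zero => exact zero
    | add f g hf hg => exact add _ _ hf hg
    | single C r =>
      rw [← mul_one r, ← smul_eq_mul, ← Finsupp.smul_single]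
      exact smul r _ (of C)

variable (k)

/-- Bilinear extension of the composition of cobordisms. -/
def compFree (S T U : Type) [Finite T] :
    (Surface (S ⊕ T) →₀ k) →ₗ[k] (Surface (T ⊕ U) →₀ k) →ₗ[k] (Surface (S ⊕ U) →₀ k) :=
  Finsupp.linearCombination k fun C => Finsupp.lmapDomain k k fun D => comp C D

theorem compFree_single_left {S T U : Type} [Finite T] (C : Surface (S ⊕ T))
    (f : Surface (T ⊕ U) →₀ k) :
    compFree k S T U (Finsupp.single C 1) f = f.mapDomain fun D => comp C D := by
  simp [compFree]

theorem compFree_single_right {S T U : Type} [Finite T] (f : Surface (S ⊕ T) →₀ k)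
    (D : Surface (T ⊕ U)) :
    compFree k S T U f (Finsupp.single D 1) = f.mapDomain fun C => comp C D := by
  have h : (compFree k S T U).flip (Finsupp.single D 1)
      = Finsupp.lmapDomain k k fun C => comp C D := by
    refine Finsupp.lhom_ext' fun C => LinearMap.ext_ring ?_
    simp [compFree]
  exact LinearMap.congr_fun h f

theorem compFree_mem_left {S T U : Type} [Finite T] {f : Surface (S ⊕ T) →₀ k}
    (hf : f ∈ localRel k (S ⊕ T)) (f' : Surface (T ⊕ U) →₀ k) :
    compFree k S T U f f' ∈ localRel k (S ⊕ U) := by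
  induction hf using Submodule.span_induction with
  | mem f hf =>
    induction f' using Finsupp.induction_linear with
    | zero => simp
    | add x y hx hy => rw [map_add]; exact add_mem hx hy
    | single D r =>
      rw [← mul_one r, ← smul_eq_mul, ← Finsupp.smul_single, map_smul, compFree_single_right]
      exact Submodule.smul_mem _ _ (Submodule.subset_span (hf.comp_right D))
  | zero => simp
  | add x y _ _ hx hy => rw [map_add]; exact add_mem hx hy
  | smul r x _ hx => rw [map_smul]; exact Submodule.smul_mem _ _ hx

theorem compFree_mem_right {S T U : Type} [Finite T] (f : Surface (S ⊕ T) →₀ k)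
    {f' : Surface (T ⊕ U) →₀ k} (hf' : f' ∈ localRel k (T ⊕ U)) :
    compFree k S T U f f' ∈ localRel k (S ⊕ U) := by
  induction hf' using Submodule.span_induction with
  | mem f' hf' =>
    induction f using Finsupp.induction_linear with
    | zero => simp
    | add x y hx hy => rw [map_add]; exact add_mem hx hy
    | single C r =>
      rw [← mul_one r, ← smul_eq_mul, ← Finsupp.smul_single, map_smul, LinearMap.smul_apply,
        compFree_single_left]
      exact Submodule.smul_mem _ _ (Submodule.subset_span (hf'.comp_left C))
  | zero => simp
  | add x y _ _ hx hy => rw [map_add]; exact add_mem hx hy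
  | smul r x _ hx => rw [map_smul]; exact Submodule.smul_mem _ _ hx

/-- Composition of linear combinations of cobordisms modulo the local relations. -/
def compModRel (S T U : Type) [Finite T] :
    ModRel k (S ⊕ T) →ₗ[k] ModRel k (T ⊕ U) →ₗ[k] ModRel k (S ⊕ U) :=
  (localRel k (S ⊕ T)).liftQ
    { toFun := fun f => (localRel k (T ⊕ U)).mapQ (localRel k (S ⊕ U)) (compFree k S T U f)
        fun _ h => compFree_mem_right k f h
      map_add' := fun f g => by
        refine Submodule.linearMap_qext _ (LinearMap.ext fun x => ?_)
        simp
      map_smul' := fun r f => by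
        refine Submodule.linearMap_qext _ (LinearMap.ext fun x => ?_)
        simp }
    fun f hf => by
      refine LinearMap.mem_ker.2 (Submodule.linearMap_qext _ (LinearMap.ext fun x => ?_))
      exact (Submodule.Quotient.mk_eq_zero _).2 (compFree_mem_left k hf x)

@[simp]
theorem compModRel_toModRel {S T U : Type} [Finite T] (C : Surface (S ⊕ T))
    (D : Surface (T ⊕ U)) :
    compModRel k S T U (toModRel k C) (toModRel k D) = toModRel k (comp C D) := by
  have h := compFree_single_left k C (Finsupp.single D 1)
  rw [Finsupp.mapDomain_single] at h
  exact congrArg Submodule.Quotient.mk h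

theorem compModRel_assoc {S T U V : Type} [Finite T] [Finite U] (x : ModRel k (S ⊕ T))
    (y : ModRel k (T ⊕ U)) (z : ModRel k (U ⊕ V)) :
    compModRel k S U V (compModRel k S T U x y) z
      = compModRel k S T V x (compModRel k T U V y z) := by
  induction x using modRel_induction with
  | zero => simp
  | add x x' hx hx' => simp only [map_add, LinearMap.add_apply, hx, hx']
  | smul r x hx => simp only [map_smul, LinearMap.smul_apply, hx]
  | of C =>
    induction y using modRel_induction with
    | zero => simp
    | add y y' hy hy' => simp only [map_add, LinearMap.add_apply, hy, hy']
    | smul r y hy => simp only [map_smul, LinearMap.smul_apply, hy]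
    | of D =>
      induction z using modRel_induction with
      | zero => simp
      | add z z' hz hz' => simp only [map_add, hz, hz']
      | smul r z hz => simp only [map_smul, hz]
      | of F => simp only [compModRel_toModRel, comp_assoc]

end Surface

/-- The objects of the category `Cobₗ` are those of `Cob`. -/
structure CobLoc (k : Type) where
  obj : Cob

namespace CobLoc

variable (k : Type) [CommRing k]

/-- The category of `k`-linear combinations of cobordisms modulo the local relations. -/
instance : Category (CobLoc k) where
  Hom S T := Surface.ModRel k (S.obj ⊕ T.obj)
  id S := Surface.toModRel k (𝟙 S.obj : S.obj ⟶ S.obj)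
  comp {S T U} x y := Surface.compModRel k S.obj T.obj U.obj x y
  id_comp {S T} x := by
    induction x using Surface.modRel_induction with
    | zero => simp
    | add x y hx hy => rw [map_add, hx, hy]
    | smul r x hx => rw [map_smul, hx]
    | of C =>
      rw [Surface.compModRel_toModRel]
      exact congrArg _ (Surface.cyl_comp C)
  comp_id {S T} x := by
    induction x using Surface.modRel_induction with
    | zero => simp
    | add x y hx hy => rw [map_add, LinearMap.add_apply, hx, hy]
    | smul r x hx => rw [map_smul, LinearMap.smul_apply, hx]
    | of C =>
      rw [Surface.compModRel_toModRel]
      exact congrArg _ (Surface.comp_cyl C)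
  assoc x y z := Surface.compModRel_assoc k x y z

instance : Preadditive (CobLoc k) where
  homGroup S T := inferInstanceAs (AddCommGroup (Surface.ModRel k (S.obj ⊕ T.obj)))
  add_comp S T U x x' y := LinearMap.map_add₂ (Surface.compModRel k S.obj T.obj U.obj) x x' y
  comp_add S T U x y y' := LinearMap.map_add (Surface.compModRel k S.obj T.obj U.obj x) y y'

instance : Linear k (CobLoc k) where
  homModule S T := inferInstanceAs (Module k (Surface.ModRel k (S.obj ⊕ T.obj)))
  smul_comp S T U r x y := LinearMap.map_smul₂ (Surface.compModRel k S.obj T.obj U.obj) r x y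
  comp_smul S T U x r y := LinearMap.map_smul (Surface.compModRel k S.obj T.obj U.obj x) r y

/-- The functor that sends a cobordism to its class modulo the local relations. -/
def fromCob : Cob ⥤ CobLoc k where
  obj S := ⟨S⟩
  map C := Surface.toModRel k C
  map_id _ := rfl
  map_comp C D := (Surface.compModRel_toModRel k C D).symm

variable {k}

/-- The tautological functor `Mor(O, -)`: it sends `O'` to the group of morphisms from `O` to `O'`
and acts on morphisms by composition. Given an endomorphism `x` of `O`, the values of the functor
are modules over the polynomial ring in one variable over `k`, where the variable acts by
precomposition with `x`. -/
def tautological (O : CobLoc k) (x : End O) : CobLoc k ⥤ ModuleCat.{0} (Polynomial k) :=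
  preadditiveCoyonedaObj O ⋙
    ModuleCat.restrictScalars (Polynomial.aeval (R := k) (MulOpposite.op x)).toRingHom

variable (k)

/-- The special 1-handle operator on the circle: the cylinder of genus one. Precomposition with it
adds a handle to the component that contains the source circle. -/
def handle : End ((fromCob k).obj Cob.circle) :=
  (fromCob k).map (Cob.connected Cob.circle Cob.circle 1)

/-- The 2-handle operator on the empty object, in the genus 3 presentation: disjoint union with one
half of the closed surface of genus 3. -/
def twoHandle : End ((fromCob ℚ).obj Cob.empty) :=
  (1 / 2 : ℚ) • (fromCob ℚ).map (Cob.connected Cob.empty Cob.empty 3)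

/-- The renormalized 2-handle operator: a quarter of the 2-handle operator. -/
def renormTwoHandle : End ((fromCob ℚ).obj Cob.empty) := (1 / 4 : ℚ) • twoHandle

end CobLoc

/-! ### Frobenius algebras and topological quantum field theories -/

/-- A Frobenius algebra structure on the commutative `R`-algebra `A`: a coalgebra structure whose
comultiplication is a map of `A`-bimodules. -/
structure FrobeniusStructure (R A : Type) [CommRing R] [CommRing A] [Algebra R A] extends
    Coalgebra R A where
  comul_mul_left (a b : A) : comul (a * b) = (a ⊗ₜ[R] 1) * comul b
  comul_mul_right (a b : A) : comul (a * b) = comul a * (1 ⊗ₜ[R] b)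
  comul_comm (a : A) : TensorProduct.comm R A A (comul a) = comul a

/-- A two-dimensional topological quantum field theory over `R` with Frobenius algebra `A`: a
functor from cobordisms to `R`-modules that maps disjoint unions to tensor products, whose value
on the circle is `A`, and whose values on the elementary cobordisms are the structure maps
of `A`. -/
structure TQFT {R A : Type} [CommRing R] [CommRing A] [Algebra R A]
    (V : FrobeniusStructure R A) where
  /-- The underlying functor. -/
  functor : Cob ⥤ ModuleCat.{0} R
  /-- The value on a union of circles is the tensor product of one copy of `A` for each circle. -/
  equiv (S : Cob) : functor.obj S ≃ₗ[R] ⨂[R] _ : S, A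
  /-- Cylinders permute the tensor factors. -/
  map_cyl {S T : Cob} (e : S ≃ T) (x : S → A) :
    equiv T (functor.map (Cob.cyl e) ((equiv S).symm (PiTensorProduct.tprod R x)))
      = PiTensorProduct.tprod R (x ∘ e.symm)
  /-- Disjoint unions of cobordisms are mapped to tensor products of linear maps. -/
  map_union {S T S' T' : Cob} (C : S ⟶ T) (D : S' ⟶ T')
    (x : functor.obj S) (y : functor.obj S') :
    equiv (T.union T') (functor.map (Cob.unionHom C D)
        ((equiv (S.union S')).symm (PiTensorProduct.tmulEquiv R A (equiv S x ⊗ₜ[R] equiv S' y))))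
      = PiTensorProduct.tmulEquiv R A
          (equiv T (functor.map C x) ⊗ₜ[R] equiv T' (functor.map D y))
  /-- The disc from the empty object to the circle is the unit of `A`. -/
  map_unit (x : Cob.empty → A) :
    equiv Cob.circle (functor.map (Cob.connected Cob.empty Cob.circle 0)
        ((equiv Cob.empty).symm (PiTensorProduct.tprod R x)))
      = PiTensorProduct.tprod R fun _ => 1
  /-- The disc from the circle to the empty object is the counit of `A`. -/
  map_counit (x : Cob.circle → A) (y : Cob.empty → A) :
    equiv Cob.empty (functor.map (Cob.connected Cob.circle Cob.empty 0)
        ((equiv Cob.circle).symm (PiTensorProduct.tprod R x)))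
      = V.counit (x ()) • PiTensorProduct.tprod R y
  /-- The pair of pants from two circles to one is the multiplication of `A`. -/
  map_mul (x : Cob.circle.union Cob.circle → A) :
    equiv Cob.circle (functor.map (Cob.connected (Cob.circle.union Cob.circle) Cob.circle 0)
        ((equiv (Cob.circle.union Cob.circle)).symm (PiTensorProduct.tprod R x)))
      = PiTensorProduct.tprod R fun _ => x (Sum.inl ()) * x (Sum.inr ())
  /-- The pair of pants from one circle to two is the comultiplication of `A`. -/
  map_comul (x : Cob.circle → A) :
    equiv (Cob.circle.union Cob.circle)
        (functor.map (Cob.connected Cob.circle (Cob.circle.union Cob.circle) 0)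
          ((equiv Cob.circle).symm (PiTensorProduct.tprod R x)))
      = PiTensorProduct.tmulEquiv R A
          (TensorProduct.map
            (PiTensorProduct.subsingletonEquiv (R := R) (s := fun _ : Cob.circle => A)
              ()).symm.toLinearMap
            (PiTensorProduct.subsingletonEquiv (R := R) (s := fun _ : Cob.circle => A)
              ()).symm.toLinearMap
            (V.comul (x ())))

/-! ### The rank two Frobenius algebras -/

namespace RankTwo

open Polynomial

variable {R : Type} [CommRing R] (h t : R)

/-- The polynomial `X² - h X - t`. -/
def poly : R[X] := X ^ 2 - C h * X - C t

theorem poly_eq : poly h t = X ^ 2 + (C (-h) * X + C (-t)) := by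
  simp [poly]; ring

theorem monic_poly : (poly h t).Monic := by
  rw [poly_eq]
  exact monic_X_pow_add (lt_of_le_of_lt degree_linear_le (by norm_num))

theorem natDegree_poly [Nontrivial R] : (poly h t).natDegree = 2 := by
  rw [poly_eq]
  compute_degree!

/-- The algebra `A = R[X] / (X² - h X - t)`. -/
abbrev Alg : Type := AdjoinRoot (poly h t)

/-- The class of `X` in `A`, also denoted `v₋`. -/
abbrev x : Alg h t := AdjoinRoot.root (poly h t)

theorem x_mul_x : x h t * x h t = h • x h t + t • (1 : Alg h t) := by
  have this : eval₂ (AdjoinRoot.of (poly h t)) (x h t) (X ^ 2 - C h * X - C t) = 0 :=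
    AdjoinRoot.eval₂_root (poly h t)
  simp only [eval₂_sub, eval₂_pow, eval₂_X, eval₂_mul, eval₂_C] at this
  rw [Algebra.smul_def, Algebra.smul_def, mul_one, AdjoinRoot.algebraMap_eq]
  linear_combination this

variable [Nontrivial R]

/-- The basis `v₊ = 1`, `v₋ = X` of `A` over `R`. -/
def basis : Module.Basis (Fin 2) R (Alg h t) :=
  (AdjoinRoot.powerBasis' (monic_poly h t)).basis.reindex (finCongr (natDegree_poly h t))

@[simp] theorem basis_zero : basis h t 0 = 1 := by
  simp [basis, finCongr]

@[simp] theorem basis_one : basis h t 1 = x h t := by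
  simp [basis, finCongr]

/-- The comultiplication `1 ↦ 1 ⊗ X + X ⊗ 1 - h 1 ⊗ 1`, `X ↦ X ⊗ X + t 1 ⊗ 1`. -/
def comul : Alg h t →ₗ[R] Alg h t ⊗[R] Alg h t :=
  (basis h t).constr R
    ![1 ⊗ₜ x h t + x h t ⊗ₜ 1 - h • (1 ⊗ₜ 1), x h t ⊗ₜ x h t + t • (1 ⊗ₜ 1)]

/-- The counit `1 ↦ 0`, `X ↦ 1`. -/
def counit : Alg h t →ₗ[R] R := (basis h t).constr R ![0, 1]

theorem comul_one : comul h t 1 = 1 ⊗ₜ x h t + x h t ⊗ₜ 1 - h • (1 ⊗ₜ 1) := by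
  rw [← basis_zero, comul, Module.Basis.constr_basis]; simp

theorem comul_x : comul h t (x h t) = x h t ⊗ₜ x h t + t • (1 ⊗ₜ 1) := by
  rw [← basis_one, comul, Module.Basis.constr_basis]; simp

theorem counit_one : counit h t 1 = 0 := by
  rw [← basis_zero, counit, Module.Basis.constr_basis]; simp

theorem counit_x : counit h t (x h t) = 1 := by
  rw [← basis_one, counit, Module.Basis.constr_basis]; simp

theorem hom_ext {M : Type} [AddCommGroup M] [Module R M] {φ ψ : Alg h t →ₗ[R] M}
    (h1 : φ 1 = ψ 1) (hx : φ (x h t) = ψ (x h t)) : φ = ψ := by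
  refine (basis h t).ext fun i => ?_
  fin_cases i
  · simpa using h1
  · simpa using hx

theorem comul_eq (a : Alg h t) : comul h t a = (a ⊗ₜ 1) * comul h t 1 := by
  have : comul h t = (LinearMap.mulRight R (comul h t 1)).comp
      (Algebra.TensorProduct.includeLeft (R := R) (S := R) (A := Alg h t)
        (B := Alg h t)).toLinearMap := by
    refine hom_ext h t ?_ ?_
    · simp [← Algebra.TensorProduct.one_def]
    · simp [comul_one, comul_x, mul_add, mul_sub, x_mul_x, TensorProduct.add_tmul,
        ← TensorProduct.smul_tmul']
      abel
  exact LinearMap.congr_fun this a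

theorem comul_comm (a : Alg h t) :
    TensorProduct.comm R _ _ (comul h t a) = comul h t a := by
  have : (TensorProduct.comm R _ _).toLinearMap.comp (comul h t) = comul h t := by
    refine hom_ext h t ?_ ?_
    · simp [comul_one, add_comm]
    · simp [comul_x]
  exact LinearMap.congr_fun this a

/-- The Frobenius algebra `A = R[X] / (X² - h X - t)`. -/
def frobenius : FrobeniusStructure R (Alg h t) where
  comul := comul h t
  counit := counit h t
  coassoc := by
    refine hom_ext h t ?_ ?_
    · simp [comul_one, comul_x, TensorProduct.tmul_add, TensorProduct.add_tmul,
        TensorProduct.tmul_sub, TensorProduct.sub_tmul, ← TensorProduct.smul_tmul']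
      module
    · simp [comul_one, comul_x, TensorProduct.tmul_add, TensorProduct.add_tmul,
        TensorProduct.tmul_sub, TensorProduct.sub_tmul, ← TensorProduct.smul_tmul']
      module
  rTensor_counit_comp_comul := by
    refine hom_ext h t ?_ ?_
    · simp [comul_one, counit_one, counit_x]
    · simp [comul_x, counit_one, counit_x]
  lTensor_counit_comp_comul := by
    refine hom_ext h t ?_ ?_
    · simp [comul_one, counit_one, counit_x]
    · simp [comul_x, counit_one, counit_x]
  comul_mul_left a b := by
    rw [comul_eq, comul_eq h t b, ← mul_assoc]
    simp
  comul_mul_right a b := by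
    have hc : ∀ y z : Alg h t ⊗[R] Alg h t, TensorProduct.comm R _ _ (y * z)
        = TensorProduct.comm R _ _ y * TensorProduct.comm R _ _ z :=
      map_mul (Algebra.TensorProduct.comm R (Alg h t) (Alg h t))
    have hl : comul h t (b * a) = (b ⊗ₜ 1) * comul h t a := by
      rw [comul_eq, comul_eq h t a, ← mul_assoc]
      simp
    rw [mul_comm a b, ← comul_comm, hl, hc, comul_comm, TensorProduct.comm_tmul, mul_comm]
  comul_comm := comul_comm h t

end RankTwo

end

/-!
Over an extension `L` of the ground ring in which `X² - h X - t` acquires two roots with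
invertible difference, `A_{h,t}` becomes `L × L` and its TQFT becomes a state sum over colourings
of the components by the two roots: a component of genus `g` coloured by `c` has the weight
`θ_c ^ (g - 1)`, where `θ_c` is the difference of the root `c` and the other one. Such a sum
respects the local relations precisely because the two differences are opposite, and evaluation at
the roots embeds `A_{h,t}^{⊗S}` into the functions on the colourings of `S`.

On the other side, 4TU trades the tubes of a surface for handles and for tubes at a base component,
so `Mor(O, S)` is generated over the polynomial ring by `2 ^ |S|` explicit surfaces: for the
circle, those of genus 0 in which some circles lie on the component of the source and the others
bound discs; for the empty object, the unions of discs with at most one handle each. Their state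
sums are the images of the monomial basis of `A_{h,t}^{⊗S}`, so they form a basis of `Mor(O, S)`,
and matching the two bases is an isomorphism of functors.
-/

noncomputable section

namespace Surface

theorem zpow_sum {G ι : Type*} [CommGroup G] [Fintype ι] (a : G) (n : ι → ℤ) :
    a ^ ∑ i, n i = ∏ i, a ^ n i :=
  map_prod (zpowersHom G a) (fun i => Multiplicative.ofAdd (n i)) Finset.univ

theorem prod_zpow_eq_prod_colors {G ι Q : Type*} [CommGroup G] [Fintype ι] [Fintype Q]
    [DecidableEq Q] (θ : Q → G) (c : ι → Q) (n : ι → ℤ) :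
    ∏ i, θ (c i) ^ n i = ∏ a, θ a ^ ∑ i, (if c i = a then 1 else 0) * n i := by
  simp_rw [zpow_sum]
  rw [Finset.prod_comm]
  simp [ite_mul, Finset.prod_ite_eq, apply_ite]

theorem prod_weight_tubes {G Q K E : Type} [CommGroup G] [Fintype K] [Fintype E] (θ : Q → G)
    (g : K → ℕ) (s t : E → K) [Fintype (TubeComp s t)] (c : TubeComp s t → Q) :
    ∏ q, θ (c q) ^ ((tubeGenus g s t q : ℤ) - 1)
      = (∏ k, θ (c (Quot.mk _ k)) ^ ((g k : ℤ) - 1)) * ∏ e, θ (c (Quot.mk _ (s e))) := by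
  classical
  have hone : ∏ e, θ (c (Quot.mk _ (s e))) = ∏ e, θ (c (Quot.mk _ (s e))) ^ (1 : ℤ) := by
    simp only [zpow_one]
  rw [hone, prod_zpow_eq_prod_colors (fun q => θ (c q)) fun k => Quot.mk _ k,
    prod_zpow_eq_prod_colors (fun q => θ (c q)) fun e => Quot.mk _ (s e),
    ← Finset.prod_mul_distrib]
  refine Finset.prod_congr rfl fun q _ => ?_
  rw [← zpow_add]
  have hsum := tubeGenus_sum g s t fun q' => if q' = q then 1 else 0
  simpa using congrArg (θ (c q) ^ ·) hsum

theorem sum_sum_arrow {K K' Q M : Type*} [Fintype (K → Q)] [Fintype (K' → Q)]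
    [Fintype (K ⊕ K' → Q)] [AddCommMonoid M] (f : (K ⊕ K' → Q) → M) :
    ∑ c, f c = ∑ c : K → Q, ∑ c' : K' → Q, f (Sum.elim c c') := by
  rw [← (Equiv.sumArrowEquivProdArrow K K' Q).symm.sum_comp, Fintype.sum_prod_type]
  rfl

section StateSum

variable {Q L : Type} [Fintype Q] [CommRing L] (θ : Q → Lˣ)

open Classical in
/-- The state sum of a surface with colours `σ` prescribed on the boundary: the sum, over all
colourings of the components that extend `σ`, of the product of the weights
`θ c ^ (genus - 1)` of the components. -/
def stateSum {B : Type} (C : Surface B) (σ : B → Q) : L :=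
  Quotient.lift (s := surfaceSetoid B)
    (fun x => ∑ c : Fin x.1 → Q,
      if c ∘ x.2.2 = σ then ((∏ k, θ (c k) ^ ((x.2.1 k : ℤ) - 1) : Lˣ) : L) else 0)
    (by
      rintro x y ⟨e, hgenus, hbdry⟩
      refine Fintype.sum_equiv (e.arrowCongr (Equiv.refl Q)) _ _ fun c => ?_
      have hc : ((e.arrowCongr (Equiv.refl Q)) c) ∘ y.2.2 = c ∘ x.2.2 := by
        funext b; simp [hbdry]
      rw [hc, ← e.prod_comp]
      simp [hgenus]) C

open Classical in
theorem stateSum_of {B K : Type} [Fintype K] [Fintype (K → Q)] (g : K → ℕ) (p : B → K)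
    (σ : B → Q) :
    stateSum θ (of g p) σ
      = ∑ c : K → Q,
          if c ∘ p = σ then ((∏ k, θ (c k) ^ ((g k : ℤ) - 1) : Lˣ) : L) else 0 := by
  symm
  refine Fintype.sum_equiv ((Finite.equivFin K).arrowCongr (Equiv.refl Q)) _ _ fun c => ?_
  have hc : (((Finite.equivFin K).arrowCongr (Equiv.refl Q)) c) ∘ Finite.equivFin K ∘ p
      = c ∘ p := by
    funext b; simp
  simp only [hc]
  rw [← (Finite.equivFin K).prod_comp]
  simp

open Classical in
theorem stateSum_tubes {B K E : Type} [Fintype K] [Fintype E] [Fintype (K → Q)] (g : K → ℕ)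
    (p : B → K) (s t : E → K) (σ : B → Q) :
    stateSum θ (tubes g p s t) σ
      = ∑ c : K → Q, if c ∘ p = σ ∧ c ∘ s = c ∘ t then
          ((∏ k, θ (c k) ^ ((g k : ℤ) - 1) : Lˣ) : L) * ((∏ e, θ (c (s e)) : Lˣ) : L) else 0 := by
  have := Fintype.ofFinite (TubeComp s t)
  rw [tubes, stateSum_of, ← Finset.sum_filter, ← Finset.sum_filter]
  refine Finset.sum_bij (fun c _ => c ∘ Quot.mk _) ?_ ?_ ?_ ?_
  · intro c hc
    refine Finset.mem_filter.2 ⟨Finset.mem_univ _, (Finset.mem_filter.1 hc).2, funext fun e => ?_⟩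
    exact congrArg c (Quot.sound ⟨e, rfl, rfl⟩)
  · intro c _ c' _ h
    funext q
    obtain ⟨k, rfl⟩ := Quot.exists_rep q
    exact congrFun h k
  · intro c hc
    obtain ⟨-, hp, hst⟩ := Finset.mem_filter.1 hc
    refine ⟨Quot.lift c ?_, Finset.mem_filter.2 ⟨Finset.mem_univ _, hp⟩, rfl⟩
    rintro _ _ ⟨e, rfl, rfl⟩
    exact congrFun hst e
  · intro c _
    rw [← Units.val_mul, prod_weight_tubes]
    rfl

open Classical in
theorem stateSum_addTube {B K : Type} [Fintype K] [Fintype (K → Q)] (g : K → ℕ) (p : B → K)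
    (i j : K) (σ : B → Q) :
    stateSum θ (addTube g p i j) σ
      = ∑ c : K → Q, (if c ∘ p = σ then ((∏ k, θ (c k) ^ ((g k : ℤ) - 1) : Lˣ) : L) else 0)
          * if c i = c j then (θ (c i) : L) else 0 := by
  rw [addTube, stateSum_tubes]
  refine Finset.sum_congr rfl fun c _ => ?_
  by_cases h : c i = c j <;> simp [funext_iff, h]

theorem stateSum_addClosed {B K : Type} [Finite K] (g : K → ℕ) (p : B → K) (n : ℕ)
    (σ : B → Q) :
    stateSum θ (addClosed g p n) σ
      = stateSum θ (of g p) σ * ∑ a, ((θ a ^ ((n : ℤ) - 1) : Lˣ) : L) := by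
  classical
  have := Fintype.ofFinite K
  rw [addClosed, stateSum_of, stateSum_of, sum_sum_arrow, Finset.sum_mul_sum]
  refine Finset.sum_congr rfl fun c _ => ?_
  refine (Fintype.sum_equiv (Equiv.funUnique Unit Q).symm _ _ fun a => ?_).symm
  have hc : Sum.elim c ((Equiv.funUnique Unit Q).symm a) ∘ (fun b => Sum.inl (p b)) = c ∘ p := rfl
  simp only [hc]
  by_cases h : c ∘ p = σ <;> simp [h]

theorem disj_of {S T S' T' K K' : Type} [Finite K] [Finite K'] (g : K → ℕ) (p : S ⊕ T → K)
    (g' : K' → ℕ) (p' : S' ⊕ T' → K') :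
    disj (of g p) (of g' p')
      = of (Sum.elim g g') (Sum.elim (Sum.map (p ∘ Sum.inl) (p' ∘ Sum.inl))
          (Sum.map (p ∘ Sum.inr) (p' ∘ Sum.inr))) := by
  refine (of_eq_of (Equiv.sumCongr (Finite.equivFin K) (Finite.equivFin K')) ?_ ?_).symm
  · rintro (k | k) <;> simp
  · rintro ((b | b) | (b | b)) <;> simp

theorem stateSum_disj {S T S' T' : Type} (C : Surface (S ⊕ T)) (D : Surface (S' ⊕ T'))
    (σ : S → Q) (σ' : S' → Q) (τ : T → Q) (τ' : T' → Q) :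
    stateSum θ (disj C D) (Sum.elim (Sum.elim σ σ') (Sum.elim τ τ'))
      = stateSum θ C (Sum.elim σ τ) * stateSum θ D (Sum.elim σ' τ') := by
  classical
  obtain ⟨n, g, p, rfl⟩ := C.exists_of
  obtain ⟨n', g', p', rfl⟩ := D.exists_of
  rw [disj_of, stateSum_of, stateSum_of, stateSum_of, sum_sum_arrow, Finset.sum_mul_sum]
  refine Finset.sum_congr rfl fun c _ => Finset.sum_congr rfl fun c' _ => ?_
  have hcolors : Sum.elim c c' ∘ (Sum.elim (Sum.map (p ∘ Sum.inl) (p' ∘ Sum.inl))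
        (Sum.map (p ∘ Sum.inr) (p' ∘ Sum.inr))) = Sum.elim (Sum.elim σ σ') (Sum.elim τ τ')
      ↔ c ∘ p = Sum.elim σ τ ∧ c' ∘ p' = Sum.elim σ' τ' := by
    simp only [funext_iff, Sum.forall, Function.comp, Sum.elim_inl, Sum.elim_inr, Sum.map_inl,
      Sum.map_inr]
    tauto
  simp only [hcolors]
  by_cases hc : c ∘ p = Sum.elim σ τ <;> by_cases hc' : c' ∘ p' = Sum.elim σ' τ' <;>
    simp [hc, hc']

theorem stateSum_comp {S T U : Type} [Fintype T] [DecidableEq T] (C : Surface (S ⊕ T))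
    (D : Surface (T ⊕ U)) (σ : S → Q) (υ : U → Q) :
    stateSum θ (comp C D) (Sum.elim σ υ)
      = ∑ τ : T → Q, stateSum θ C (Sum.elim σ τ) * ((∏ t, θ (τ t) : Lˣ) : L)
          * stateSum θ D (Sum.elim τ υ) := by
  classical
  obtain ⟨n, g, p, rfl⟩ := C.exists_of
  obtain ⟨n', g', p', rfl⟩ := D.exists_of
  rw [comp_of, stateSum_tubes, sum_sum_arrow]
  simp_rw [stateSum_of, Finset.sum_mul, Finset.mul_sum]
  rw [Finset.sum_comm (s := Finset.univ (α := T → Q))]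
  refine Finset.sum_congr rfl fun c _ => ?_
  rw [Finset.sum_comm]
  refine Finset.sum_congr rfl fun c' _ => ?_
  let τ : T → Q := fun t => c (p (Sum.inr t))
  have hcolors : (Sum.elim c c' ∘ Sum.map (p ∘ Sum.inl) (p' ∘ Sum.inr) = Sum.elim σ υ ∧
      (Sum.elim c c' ∘ fun b : T => Sum.inl (p (Sum.inr b)))
        = Sum.elim c c' ∘ fun b : T => Sum.inr (p' (Sum.inl b)))
      ↔ c ∘ p = Sum.elim σ τ ∧ c' ∘ p' = Sum.elim τ υ := by
    simp only [funext_iff, Sum.forall, Function.comp, Sum.elim_inl, Sum.elim_inr, Sum.map_inl,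
      Sum.map_inr, τ]
    grind
  rw [Finset.sum_eq_single τ]
  · simp only [hcolors]
    by_cases hc : c ∘ p = Sum.elim σ τ
    · by_cases hc' : c' ∘ p' = Sum.elim τ υ
      · simp only [hc, hc', and_self, if_true, Fintype.prod_sum_type, Sum.elim_inl, Sum.elim_inr,
          Units.val_mul, τ]
        ring
      · simp only [hc', and_false, if_false, mul_zero]
    · simp only [hc, false_and, if_false, zero_mul]
  · intro τ' _ hτ
    rw [if_neg, zero_mul, zero_mul]
    intro h
    exact hτ (funext fun t => (congrFun h (Sum.inr t)).symm)
  · simp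

open Classical in
theorem stateSum_connected {B : Type} (n : ℕ) (σ : B → Q) :
    stateSum θ (connected B n) σ
      = ∑ a, if (fun _ => a) = σ then ((θ a ^ ((n : ℤ) - 1) : Lˣ) : L) else 0 := by
  rw [connected, stateSum_of θ (K := Unit)]
  refine (Fintype.sum_equiv (Equiv.funUnique Unit Q).symm _ _ fun a => ?_).symm
  refine if_congr Iff.rfl ?_ rfl
  simp

open Classical in
theorem stateSum_cyl {S T : Type} [Fintype S] (e : S ≃ T) (σ : S → Q) (τ : T → Q) :
    stateSum θ (cyl e) (Sum.elim σ τ)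
      = if σ = τ ∘ e then (((∏ s, θ (σ s))⁻¹ : Lˣ) : L) else 0 := by
  rw [cyl, stateSum_of, Finset.sum_eq_single σ]
  · have hcolors : σ ∘ Sum.elim id e.symm = Sum.elim σ τ ↔ σ = τ ∘ e := by
      simp only [funext_iff, Sum.forall, Function.comp, Sum.elim_inl, Sum.elim_inr, id,
        implies_true, true_and]
      constructor
      · intro h s; rw [← h, e.symm_apply_apply]
      · intro h t; rw [h, e.apply_symm_apply]
    simp [hcolors]
  · intro c _ hc
    rw [if_neg]
    intro h
    exact hc (funext fun s => congrFun h (Sum.inl s))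
  · simp

end StateSum

section Transfer

variable {Q L : Type} [Fintype Q] [CommRing L] (θ : Q → Lˣ)
variable {S T U S' T' : Type} [Finite S] [Finite T] [Finite U] [Finite S'] [Finite T']

open Classical in
/-- The transfer operator of a cobordism, a map between the spaces of functions of the colourings
of its two ends. Its kernel is the state sum times the weights `θ` of the target circles, which
makes it compatible with gluing. -/
def transfer (C : Surface (S ⊕ T)) : ((S → Q) → L) →ₗ[L] ((T → Q) → L) :=
  letI := Fintype.ofFinite S
  letI := Fintype.ofFinite T
  LinearMap.pi fun τ => ((∏ b, θ (τ b) : Lˣ) : L) •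
    ∑ σ, stateSum θ C (Sum.elim σ τ) • LinearMap.proj σ

theorem transfer_apply [Fintype (S → Q)] [Fintype T] (C : Surface (S ⊕ T))
    (f : (S → Q) → L) (τ : T → Q) :
    transfer θ C f τ
      = ((∏ b, θ (τ b) : Lˣ) : L) * ∑ σ, stateSum θ C (Sum.elim σ τ) * f σ := by
  rw [transfer, LinearMap.pi_apply, LinearMap.smul_apply, LinearMap.sum_apply, smul_eq_mul]
  congr!

theorem transfer_comp (C : Surface (S ⊕ T)) (D : Surface (T ⊕ U)) :
    transfer θ (comp C D) = transfer θ D ∘ₗ transfer θ C := by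
  classical
  have := Fintype.ofFinite S
  have := Fintype.ofFinite T
  have := Fintype.ofFinite U
  refine LinearMap.ext fun f => funext fun υ => ?_
  simp_rw [LinearMap.comp_apply, transfer_apply, stateSum_comp, Finset.sum_mul, Finset.mul_sum]
  rw [Finset.sum_comm]
  refine Finset.sum_congr rfl fun τ _ => Finset.sum_congr rfl fun σ _ => ?_
  ring

theorem transfer_cyl (e : S ≃ T) (f : (S → Q) → L) :
    transfer θ (cyl e) f = fun τ => f (τ ∘ e) := by
  classical
  have := Fintype.ofFinite S
  have := Fintype.ofFinite T
  funext τ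
  simp only [transfer_apply, stateSum_cyl]
  rw [Finset.sum_eq_single (τ ∘ e)]
  · rw [if_pos rfl, ← mul_assoc, ← e.prod_comp]
    exact (congrArg (· * _) (Units.mul_inv _)).trans (one_mul _)
  · intro σ _ hσ
    rw [if_neg hσ, zero_mul]
  · simp

theorem transfer_disj (C : Surface (S ⊕ T)) (D : Surface (S' ⊕ T')) (f : (S → Q) → L)
    (f' : (S' → Q) → L) :
    transfer θ (disj C D) (fun σ => f (σ ∘ Sum.inl) * f' (σ ∘ Sum.inr))
      = fun τ => transfer θ C f (τ ∘ Sum.inl) * transfer θ D f' (τ ∘ Sum.inr) := by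
  classical
  have := Fintype.ofFinite S
  have := Fintype.ofFinite T
  have := Fintype.ofFinite S'
  have := Fintype.ofFinite T'
  funext τ
  rw [← Sum.elim_comp_inl_inr τ]
  simp only [transfer_apply, stateSum_disj, sum_sum_arrow, Sum.elim_comp_inl, Sum.elim_comp_inr,
    Fintype.prod_sum_type, Sum.elim_inl, Sum.elim_inr, Units.val_mul]
  rw [mul_mul_mul_comm, Finset.sum_mul_sum]
  congr 1
  refine Finset.sum_congr rfl fun σ _ => Finset.sum_congr rfl fun σ' _ => ?_
  ring

open Classical in
theorem transfer_connected [Fintype T] (n : ℕ) (f : (S → Q) → L) (τ : T → Q) :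
    transfer θ (connected (S ⊕ T) n) f τ
      = ∑ a, if τ = fun _ => a then
          ((θ a ^ ((n : ℤ) - 1 + Fintype.card T) : Lˣ) : L) * f fun _ => a else 0 := by
  have := Fintype.ofFinite S
  simp only [transfer_apply, stateSum_connected, Finset.sum_mul]
  rw [Finset.sum_comm, Finset.mul_sum]
  refine Finset.sum_congr rfl fun a _ => ?_
  rw [Finset.sum_eq_single fun _ => a]
  · have hcolors : ((fun _ => a) = Sum.elim (fun _ : S => a) τ) ↔ τ = fun _ => a := by
      simp only [funext_iff, Sum.forall, Sum.elim_inl, Sum.elim_inr, implies_true, true_and]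
      exact forall_congr' fun _ => eq_comm
    simp only [hcolors]
    split_ifs with hτ
    · subst hτ
      rw [← mul_assoc, ← Units.val_mul, zpow_add, mul_comm (∏ _, _)]
      simp
    · simp
  · intro σ _ hσ
    rw [if_neg, zero_mul]
    intro h
    exact hσ (funext fun x => (congrFun h (Sum.inl x)).symm)
  · simp

theorem transfer_connected_of_isEmpty [IsEmpty T] (n : ℕ) (f : (S → Q) → L) (τ : T → Q) :
    transfer θ (connected (S ⊕ T) n) f τ
      = ∑ a, ((θ a ^ ((n : ℤ) - 1) : Lˣ) : L) * f fun _ => a := by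
  have := Fintype.ofFinite T
  rw [transfer_connected]
  refine Finset.sum_congr rfl fun a _ => ?_
  rw [if_pos (Subsingleton.elim _ _), Fintype.card_of_isEmpty, Nat.cast_zero, add_zero]

open Classical in
theorem transfer_connected_of_mem [Fintype T] (b : T) (n : ℕ) (f : (S → Q) → L) (τ : T → Q) :
    transfer θ (connected (S ⊕ T) n) f τ
      = if τ = fun _ => τ b then
          ((θ (τ b) ^ ((n : ℤ) - 1 + Fintype.card T) : Lˣ) : L) * f fun _ => τ b else 0 := by
  rw [transfer_connected, Finset.sum_eq_single (τ b)]
  · intro a _ ha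
    exact if_neg fun h => ha (congrFun h b).symm
  · simp

end Transfer

section LocalRelations

variable {L : Type} [CommRing L] {θ : Bool → Lˣ} {k : Type} [CommRing k] [Algebra k L]

/-- The neck of a tube contributes the sum of a function of the colours of its two ends, which is
what 4TU expresses. -/
theorem ite_eq_add (hθ : (θ false : L) = -θ true) (a b : Bool) [Decidable (a = b)] :
    (if a = b then (θ a : L) else 0)
      = (if a then (θ true : L) else 0) + (if b then (θ true : L) else 0) - θ true := by
  cases a <;> cases b <;> simp [hθ]

theorem linearCombination_stateSum_eq_zero (hθ : (θ false : L) = -θ true) {B : Type}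
    {f : Surface B →₀ k} (hf : f ∈ localRel k B) (σ : B → Bool) :
    Finsupp.linearCombination k (fun C => stateSum θ C σ) f = 0 := by
  classical
  induction hf using Submodule.span_induction with
  | zero => simp
  | add x y _ _ hx hy => rw [map_add, hx, hy, add_zero]
  | smul a x _ hx => rw [map_smul, hx, smul_zero]
  | mem f hf =>
    cases hf with
    | fourTu g p D =>
      have := Fintype.ofFinite ‹Type›
      simp only [map_sub, map_add, Finsupp.linearCombination_single, one_smul, stateSum_addTube,
        ite_eq_add hθ, ← Finset.sum_add_distrib, ← Finset.sum_sub_distrib]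
      refine Finset.sum_eq_zero fun c _ => ?_
      ring
    | sphere g p =>
      have hinv : θ false = -θ true := Units.ext hθ
      simp [stateSum_addClosed, hinv, inv_neg]
    | torus g p =>
      simp only [map_sub, Finsupp.linearCombination_single, stateSum_addClosed, Fintype.sum_bool,
        Nat.cast_one, sub_self, zpow_zero, Units.val_one, Algebra.smul_def, map_one, map_ofNat]
      ring

variable {S T U : Type} [Finite S] [Finite T] [Finite U]

variable (k) in
/-- The operator of a linear combination of cobordisms modulo the local relations, for two colours
of opposite weights. -/
def transferMap (hθ : (θ false : L) = -θ true) :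
    ModRel k (S ⊕ T) →ₗ[k] ((S → Bool) → L) →ₗ[L] ((T → Bool) → L) :=
  (localRel k (S ⊕ T)).liftQ (Finsupp.linearCombination k (transfer θ)) fun f hf => by
    classical
    have := Fintype.ofFinite S
    have := Fintype.ofFinite T
    refine LinearMap.mem_ker.2 (LinearMap.ext fun v => funext fun τ => ?_)
    have h : ∀ σ : S → Bool, f.sum (fun C a => a • stateSum θ C (Sum.elim σ τ)) = 0 := fun σ =>
      linearCombination_stateSum_eq_zero hθ hf (Sum.elim σ τ)
    simp only [Finsupp.sum] at h
    simp only [Finsupp.linearCombination_apply, Finsupp.sum, LinearMap.sum_apply, Finset.sum_apply,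
      LinearMap.smul_apply, Pi.smul_apply, transfer_apply, Finset.mul_sum, Finset.smul_sum]
    rw [Finset.sum_comm]
    refine Finset.sum_eq_zero fun σ _ => ?_
    simp only [mul_left_comm ((∏ b, θ (τ b) : Lˣ) : L), ← smul_mul_assoc, ← Finset.sum_mul, h,
      zero_mul]

@[simp]
theorem transferMap_toModRel (hθ : (θ false : L) = -θ true) (C : Surface (S ⊕ T)) :
    transferMap k hθ (toModRel k C) = transfer θ C := by
  simp [transferMap, toModRel]

theorem transferMap_compModRel (hθ : (θ false : L) = -θ true) (x : ModRel k (S ⊕ T))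
    (y : ModRel k (T ⊕ U)) :
    transferMap k hθ (compModRel k S T U x y) = transferMap k hθ y ∘ₗ transferMap k hθ x := by
  induction x using modRel_induction with
  | zero => simp
  | add x x' hx hx' => simp only [map_add, LinearMap.add_apply, hx, hx', LinearMap.comp_add]
  | smul a x hx => rw [map_smul, LinearMap.smul_apply, map_smul, map_smul, hx, LinearMap.comp_smul]
  | of C =>
    induction y using modRel_induction with
    | zero => simp
    | add y y' hy hy' => simp only [map_add, hy, hy', LinearMap.add_comp]
    | smul a y hy => rw [map_smul, map_smul, map_smul, hy, LinearMap.smul_comp]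
    | of D => simp [transfer_comp]

end LocalRelations

end Surface

namespace RankTwo

/-- A splitting of `X² - h X - t` over `L` into linear factors whose roots have an invertible
difference; `diff b` is the difference of the root `b` and the other one. -/
structure Splitting {R : Type} (L : Type) [CommRing R] [CommRing L] [Algebra R L] (h t : R) where
  root : Bool → L
  diff : Bool → Lˣ
  diff_eq (b : Bool) : (diff b : L) = root b - root (!b)
  root_add : root true + root false = algebraMap R L h
  root_mul : root true * root false = -algebraMap R L t

namespace Splitting

variable {R L : Type} [CommRing R] [CommRing L] [Algebra R L] {h t : R} (s : Splitting L h t)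

theorem diff_false : (s.diff false : L) = -s.diff true := by
  rw [diff_eq, diff_eq, Bool.not_false, Bool.not_true, neg_sub]

theorem root_mul_root (b : Bool) :
    s.root b * s.root b = algebraMap R L h * s.root b + algebraMap R L t := by
  rw [← s.root_add]
  cases b <;> linear_combination -s.root_mul

theorem root_add_root (a b : Bool) :
    s.root a + s.root b - algebraMap R L h = if a = b then (s.diff a : L) else 0 := by
  rw [← s.root_add]
  cases a <;> cases b
  · rw [if_pos rfl, diff_eq, Bool.not_false, add_sub_add_right_eq_sub]
  · rw [if_neg Bool.false_ne_true, add_comm, sub_self]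
  · rw [if_neg Bool.false_ne_true.symm, sub_self]
  · rw [if_pos rfl, diff_eq, Bool.not_true, add_sub_add_left_eq_sub]

/-- Evaluation of `A = R[X] / (X² - h X - t)` at a root. -/
def eval (b : Bool) : Alg h t →ₐ[R] L :=
  AdjoinRoot.liftAlgHom (poly h t) (Algebra.ofId R L) (s.root b) (by
    simp only [Algebra.toRingHom_ofId, poly, Polynomial.eval₂_sub, Polynomial.eval₂_X_pow,
      Polynomial.eval₂_mul, Polynomial.eval₂_C, Polynomial.eval₂_X]
    linear_combination s.root_mul_root b)

@[simp]
theorem eval_x (b : Bool) : s.eval b (x h t) = s.root b := by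
  simp [eval]

theorem inv_diff_false : (((s.diff false)⁻¹ : Lˣ) : L) = -((s.diff true)⁻¹ : Lˣ) := by
  rw [show s.diff false = -s.diff true from Units.ext s.diff_false, inv_neg, Units.val_neg]

theorem sum_inv_diff :
    (((s.diff true)⁻¹ : Lˣ) : L) + (((s.diff false)⁻¹ : Lˣ) : L) = 0 := by
  rw [inv_diff_false, add_neg_cancel]

theorem sum_root_mul_inv_diff :
    s.root true * ((s.diff true)⁻¹ : Lˣ) + s.root false * ((s.diff false)⁻¹ : Lˣ) = 1 := by
  have hdiff : (s.diff true : L) = s.root true - s.root false := s.diff_eq true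
  rw [inv_diff_false, ← (s.diff true).mul_inv, hdiff]
  ring

section EvalTensor

variable {S S' : Type} [Finite S] [Finite S']

/-- The evaluation of tensors at all choices of roots, one for each tensor factor. -/
def evalTensor (S : Type) [Finite S] : (⨂[R] _ : S, Alg h t) →ₗ[R] ((S → Bool) → L) :=
  letI := Fintype.ofFinite S
  LinearMap.pi fun σ => PiTensorProduct.lift
    ((MultilinearMap.mkPiAlgebra R S L).compLinearMap fun b => (s.eval (σ b)).toLinearMap)

@[simp]
theorem evalTensor_tprod [Fintype S] (y : S → Alg h t) (σ : S → Bool) :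
    s.evalTensor S (PiTensorProduct.tprod R y) σ = ∏ b, s.eval (σ b) (y b) := by
  simp only [evalTensor, LinearMap.pi_apply, PiTensorProduct.lift.tprod,
    MultilinearMap.compLinearMap_apply, MultilinearMap.mkPiAlgebra_apply]
  congr!

theorem evalTensor_tmulEquiv (y : ⨂[R] _ : S, Alg h t) (z : ⨂[R] _ : S', Alg h t) :
    s.evalTensor (S ⊕ S') (PiTensorProduct.tmulEquiv R _ (y ⊗ₜ[R] z))
      = fun σ => s.evalTensor S y (σ ∘ Sum.inl) * s.evalTensor S' z (σ ∘ Sum.inr) := by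
  have := Fintype.ofFinite S
  have := Fintype.ofFinite S'
  funext σ
  induction y using PiTensorProduct.induction_on with
  | add y y' hy hy' => simp only [TensorProduct.add_tmul, map_add, Pi.add_apply, hy, hy', add_mul]
  | smul_tprod r y =>
    induction z using PiTensorProduct.induction_on with
    | add z z' hz hz' =>
      simp only [TensorProduct.tmul_add, map_add, Pi.add_apply, hz, hz', mul_add]
    | smul_tprod r' z =>
      simp only [TensorProduct.tmul_smul, ← TensorProduct.smul_tmul', map_smul, Pi.smul_apply,
        PiTensorProduct.tmulEquiv_apply, evalTensor_tprod, Fintype.prod_sum_type, Sum.elim_inl,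
        Sum.elim_inr, Function.comp, smul_mul_smul_comm, smul_smul, mul_comm]

theorem evalTensor_tmulEquiv_map_symm (y : Alg h t ⊗[R] Alg h t) (τ : Unit ⊕ Unit → Bool) :
    s.evalTensor (Unit ⊕ Unit) (PiTensorProduct.tmulEquiv R (Alg h t)
        (TensorProduct.map
          (PiTensorProduct.subsingletonEquiv (R := R) (s := fun _ : Unit => Alg h t)
            ()).symm.toLinearMap
          (PiTensorProduct.subsingletonEquiv (R := R) (s := fun _ : Unit => Alg h t)
            ()).symm.toLinearMap y)) τ
      = TensorProduct.lift ((LinearMap.mul R L).compl₁₂ (s.eval (τ (Sum.inl ()))).toLinearMap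
          (s.eval (τ (Sum.inr ()))).toLinearMap) y := by
  induction y using TensorProduct.induction_on with
  | zero => simp
  | add y y' hy hy' => simp only [map_add, Pi.add_apply, hy, hy']
  | tmul y y' =>
    rw [TensorProduct.map_tmul, evalTensor_tmulEquiv]
    simp

end EvalTensor

/-- The matrix inverse to the values of the basis `1`, `X` at the roots. -/
def dualWeight (i : Fin 2) (b : Bool) : L :=
  ![s.root b - algebraMap R L h, 1] i * ((s.diff b)⁻¹ : Lˣ)

theorem dualWeight_zero (b : Bool) :
    s.dualWeight 0 b = (s.root b - algebraMap R L h) * ((s.diff b)⁻¹ : Lˣ) := rfl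

theorem dualWeight_one (b : Bool) : s.dualWeight 1 b = ((s.diff b)⁻¹ : Lˣ) := one_mul _

section Nontrivial

variable [Nontrivial R]

theorem sum_inv_diff_mul_eval (a : Alg h t) :
    ∑ b, ((s.diff b)⁻¹ : Lˣ) * s.eval b a = algebraMap R L (counit h t a) := by
  have hmaps : ∑ b, (((s.diff b)⁻¹ : Lˣ) : L) • (s.eval b).toLinearMap
      = (Algebra.linearMap R L).comp (counit h t) := by
    refine hom_ext h t ?_ ?_
    · simpa [counit_one] using s.sum_inv_diff
    · simpa [counit_x, mul_comm] using s.sum_root_mul_inv_diff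
  simpa using LinearMap.congr_fun hmaps a

theorem lift_eval_comul (a b : Bool) (y : Alg h t) :
    TensorProduct.lift ((LinearMap.mul R L).compl₁₂ (s.eval a).toLinearMap
      (s.eval b).toLinearMap) (comul h t y)
      = if a = b then s.diff a * s.eval a y else 0 := by
  have hmaps : TensorProduct.lift ((LinearMap.mul R L).compl₁₂ (s.eval a).toLinearMap
      (s.eval b).toLinearMap) ∘ₗ comul h t
      = (if a = b then (s.diff a : L) else 0) • (s.eval a).toLinearMap := by
    rw [← s.root_add_root]
    refine hom_ext h t ?_ ?_
    · simp only [LinearMap.comp_apply, comul_one, map_sub, map_add, map_smul,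
        TensorProduct.lift.tmul, LinearMap.compl₁₂_apply, AlgHom.toLinearMap_apply, eval_x,
        map_one, LinearMap.mul_apply_apply, LinearMap.smul_apply, smul_eq_mul, one_mul, mul_one]
      rw [Algebra.smul_def]
      ring
    · simp only [LinearMap.comp_apply, comul_x, map_add, map_smul, TensorProduct.lift.tmul,
        LinearMap.compl₁₂_apply, AlgHom.toLinearMap_apply, eval_x, map_one,
        LinearMap.mul_apply_apply, LinearMap.smul_apply, smul_eq_mul, mul_one]
      rw [Algebra.smul_def]
      linear_combination -s.root_mul_root a
  have hy := LinearMap.congr_fun hmaps y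
  rw [LinearMap.comp_apply] at hy
  rw [hy]
  split_ifs <;> simp

theorem sum_dualWeight (i j : Fin 2) :
    ∑ b, s.dualWeight i b * s.eval b (basis h t j) = if j = i then 1 else 0 := by
  have hsum := s.sum_inv_diff
  have hroot := s.sum_root_mul_inv_diff
  fin_cases i <;> fin_cases j <;>
    simp only [Fin.zero_eta, Fin.mk_one, dualWeight_zero, dualWeight_one, basis_zero, basis_one,
      map_one, eval_x, mul_one, Fintype.sum_bool, one_ne_zero, zero_ne_one, if_true, if_false]
  · linear_combination hroot - algebraMap R L h * hsum
  · linear_combination (((s.diff true)⁻¹ : Lˣ) : L) * s.root_mul_root true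
      + (((s.diff false)⁻¹ : Lˣ) : L) * s.root_mul_root false + algebraMap R L t * hsum
  · exact hsum
  · linear_combination hroot

theorem evalTensor_injective (hinj : Function.Injective (algebraMap R L)) (S : Type) [Finite S] :
    Function.Injective (s.evalTensor S) := by
  classical
  have := Fintype.ofFinite S
  let B := Basis.piTensorProduct (fun _ : S => basis h t)
  rw [injective_iff_map_eq_zero]
  intro y hy
  refine B.ext_elem fun κ => hinj ?_
  have hcoord : (∑ σ : S → Bool, (∏ b, s.dualWeight (κ b) (σ b)) •
      (LinearMap.proj σ ∘ₗ s.evalTensor S)) = Algebra.linearMap R L ∘ₗ B.coord κ := by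
    refine B.ext fun κ' => ?_
    simp only [B, LinearMap.sum_apply, LinearMap.smul_apply, LinearMap.comp_apply,
      LinearMap.proj_apply, Basis.piTensorProduct_apply, evalTensor_tprod, smul_eq_mul,
      ← Finset.prod_mul_distrib]
    rw [← Fintype.prod_sum (fun a b => s.dualWeight (κ a) b * s.eval b (basis h t (κ' a)))]
    simp only [sum_dualWeight]
    rw [← Basis.piTensorProduct_apply]
    simp [Finsupp.single_apply, Finset.prod_ite_zero]
  simpa [hy] using (LinearMap.congr_fun hcoord y).symm

end Nontrivial

theorem transfer_unit (y : Empty → Alg h t) :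
    Surface.transfer s.diff (Surface.connected (Empty ⊕ Unit) 0)
        (s.evalTensor Empty (PiTensorProduct.tprod R y))
      = s.evalTensor Unit (PiTensorProduct.tprod R fun _ => 1) := by
  funext τ
  rw [Surface.transfer_connected_of_mem _ (), if_pos rfl]
  simp

theorem transfer_mul (y : Unit ⊕ Unit → Alg h t) :
    Surface.transfer s.diff (Surface.connected ((Unit ⊕ Unit) ⊕ Unit) 0)
        (s.evalTensor (Unit ⊕ Unit) (PiTensorProduct.tprod R y))
      = s.evalTensor Unit
          (PiTensorProduct.tprod R fun _ => y (Sum.inl ()) * y (Sum.inr ())) := by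
  funext τ
  rw [Surface.transfer_connected_of_mem _ (), if_pos rfl]
  simp

variable [Nontrivial R]

theorem transfer_counit (y : Unit → Alg h t) (z : Empty → Alg h t) :
    Surface.transfer s.diff (Surface.connected (Unit ⊕ Empty) 0)
        (s.evalTensor Unit (PiTensorProduct.tprod R y))
      = s.evalTensor Empty (counit h t (y ()) • PiTensorProduct.tprod R z) := by
  funext τ
  rw [Surface.transfer_connected_of_isEmpty, map_smul, Pi.smul_apply, Algebra.smul_def,
    ← s.sum_inv_diff_mul_eval]
  simp

theorem transfer_comul (y : Unit → Alg h t) :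
    Surface.transfer s.diff (Surface.connected (Unit ⊕ (Unit ⊕ Unit)) 0)
        (s.evalTensor Unit (PiTensorProduct.tprod R y))
      = s.evalTensor (Unit ⊕ Unit) (PiTensorProduct.tmulEquiv R (Alg h t)
          (TensorProduct.map
            (PiTensorProduct.subsingletonEquiv (R := R) (s := fun _ : Unit => Alg h t)
              ()).symm.toLinearMap
            (PiTensorProduct.subsingletonEquiv (R := R) (s := fun _ : Unit => Alg h t)
              ()).symm.toLinearMap
            (comul h t (y ())))) := by
  funext τ
  have hτ : (τ = fun _ => τ (Sum.inl ())) ↔ τ (Sum.inl ()) = τ (Sum.inr ()) := by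
    refine ⟨fun hconst => (congrFun hconst (Sum.inr ())).symm, fun heq => funext fun b => ?_⟩
    rcases b with _ | _
    exacts [rfl, heq.symm]
  rw [evalTensor_tmulEquiv_map_symm, lift_eval_comul,
    Surface.transfer_connected_of_mem _ (Sum.inl ())]
  by_cases hcolors : τ (Sum.inl ()) = τ (Sum.inr ())
  · rw [if_pos (hτ.2 hcolors), if_pos hcolors]
    simp
  · rw [if_neg (mt hτ.1 hcolors), if_neg hcolors]

/-- A functor on cobordisms with values in tensor powers of `R[X] / (X² - h X - t)` that becomes
the state sum after evaluation at the roots is a topological quantum field theory. -/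
def tqft (hinj : Function.Injective (algebraMap R L)) (F : Cob ⥤ ModuleCat.{0} R)
    (E : ∀ S : Cob, F.obj S ≃ₗ[R] ⨂[R] _ : S, Alg h t)
    (hE : ∀ (S T : Cob) (C : S ⟶ T) (y : ⨂[R] _ : S, Alg h t),
      s.evalTensor T (E T (F.map C ((E S).symm y)))
        = Surface.transfer s.diff C (s.evalTensor S y)) :
    TQFT (frobenius h t) where
  functor := F
  equiv := E
  map_cyl {S T} e y := by
    have := Fintype.ofFinite S
    have := Fintype.ofFinite T
    refine s.evalTensor_injective hinj T ?_
    rw [hE]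
    refine (Surface.transfer_cyl s.diff e _).trans (funext fun τ => ?_)
    rw [s.evalTensor_tprod, s.evalTensor_tprod, ← e.prod_comp]
    simp
  map_union {S T S' T'} C D y z := by
    refine s.evalTensor_injective hinj (T ⊕ T') ?_
    refine (hE (S.union S') (T.union T') _ _).trans ?_
    refine (congrArg _ (s.evalTensor_tmulEquiv (E S y) (E S' z))).trans ?_
    refine (Surface.transfer_disj s.diff C D _ _).trans ?_
    rw [s.evalTensor_tmulEquiv, ← hE, ← hE, LinearEquiv.symm_apply_apply,
      LinearEquiv.symm_apply_apply]
  map_unit y :=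
    s.evalTensor_injective hinj Unit ((hE Cob.empty Cob.circle _ _).trans (s.transfer_unit y))
  map_counit y z :=
    s.evalTensor_injective hinj Empty ((hE Cob.circle Cob.empty _ _).trans (s.transfer_counit y z))
  map_mul y :=
    s.evalTensor_injective hinj Unit
      ((hE (Cob.circle.union Cob.circle) Cob.circle _ _).trans (s.transfer_mul y))
  map_comul y :=
    s.evalTensor_injective hinj (Unit ⊕ Unit)
      ((hE Cob.circle (Cob.circle.union Cob.circle) _ _).trans (s.transfer_comul y))

end Splitting

end RankTwo

theorem exists_linearEquiv_comp_eq_of_basis {R M N P ι : Type} [CommRing R] [AddCommGroup M]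
    [AddCommGroup N] [AddCommGroup P] [Module R M] [Module R N] [Module R P] (Ψ : M →ₗ[R] P)
    (Φ : N →ₗ[R] P) (hΦ : Function.Injective Φ) (b : Module.Basis ι R N) (e : ι → M)
    (he : ∀ i, Ψ (e i) = Φ (b i)) (hspan : Submodule.span R (Set.range e) = ⊤) :
    ∃ E : M ≃ₗ[R] N, Φ ∘ₗ E.toLinearMap = Ψ := by
  have hli : LinearIndependent R e := by
    refine LinearIndependent.of_comp Ψ ?_
    rw [show Ψ ∘ e = Φ ∘ b from funext he]
    exact b.linearIndependent.map' Φ (LinearMap.ker_eq_bot.2 hΦ)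
  refine ⟨(Module.Basis.mk hli hspan.ge).equiv b (Equiv.refl ι),
    (Module.Basis.mk hli hspan.ge).ext fun i => ?_⟩
  rw [LinearMap.comp_apply, LinearEquiv.coe_coe, Module.Basis.equiv_apply,
    Module.Basis.mk_apply, he, Equiv.refl_apply]

namespace CobLoc

variable {k : Type} [CommRing k] (O : Cob) (x : Surface.ModRel k (O ⊕ O))

/-- The values of the tautological functor `Mor(O, -)`, seen as linear combinations of cobordisms;
the polynomial variable acts on them by precomposition with `x`. -/
def tautologicalEquiv (S : Cob) :
    (fromCob k ⋙ tautological ((fromCob k).obj O) x).obj S ≃+ Surface.ModRel k (O ⊕ S) :=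
  AddEquiv.refl _

theorem tautologicalEquiv_X_smul (S : Cob)
    (y : (fromCob k ⋙ tautological ((fromCob k).obj O) x).obj S) :
    tautologicalEquiv O x S ((Polynomial.X : Polynomial k) • y)
      = Surface.compModRel k O O S x (tautologicalEquiv O x S y) := by
  change (Polynomial.aeval (R := k)
    (MulOpposite.op (show End ((fromCob k).obj O) from x)) Polynomial.X).unop ≫
    (tautologicalEquiv O x S y : (fromCob k).obj O ⟶ (fromCob k).obj S) = _
  rw [Polynomial.aeval_X]
  rfl

theorem tautologicalEquiv_C_smul (S : Cob) (a : k)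
    (y : (fromCob k ⋙ tautological ((fromCob k).obj O) x).obj S) :
    tautologicalEquiv O x S (Polynomial.C a • y) = a • tautologicalEquiv O x S y := by
  have h : ∀ z : (fromCob k).obj O ⟶ (fromCob k).obj S,
      (a • 𝟙 ((fromCob k).obj O)) ≫ z = a • z := by
    intro z
    rw [Linear.smul_comp, Category.id_comp]
  refine Eq.trans ?_ (h (tautologicalEquiv O x S y))
  change (Polynomial.aeval (R := k)
    (MulOpposite.op (show End ((fromCob k).obj O) from x)) (Polynomial.C a)).unop ≫
    (tautologicalEquiv O x S y : (fromCob k).obj O ⟶ (fromCob k).obj S) = _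
  rw [Polynomial.aeval_C]
  rfl

/-- The linear combinations of cobordisms from `O` to `S` are generated by the family `e` under
precomposition with `x`. -/
def Generates {ι : Type} (S : Cob) (e : ι → Surface.ModRel k (O ⊕ S)) : Prop :=
  ∀ W : Submodule k (Surface.ModRel k (O ⊕ S)),
    (∀ y ∈ W, Surface.compModRel k O O S x y ∈ W) → (∀ i, e i ∈ W) → W = ⊤

theorem Generates.span_eq_top {ι : Type} {S : Cob} {e : ι → Surface.ModRel k (O ⊕ S)}
    (he : Generates O x S e) :
    Submodule.span (Polynomial k) (Set.range ((tautologicalEquiv O x S).symm ∘ e)) = ⊤ := by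
  set N := Submodule.span (Polynomial k) (Set.range ((tautologicalEquiv O x S).symm ∘ e))
  have hC (a : k) (y) : (tautologicalEquiv O x S).symm (a • y)
      = Polynomial.C a • (tautologicalEquiv O x S).symm y := by
    rw [AddEquiv.symm_apply_eq, tautologicalEquiv_C_smul, AddEquiv.apply_symm_apply]
  have hX (y) : (tautologicalEquiv O x S).symm (Surface.compModRel k O O S x y)
      = (Polynomial.X : Polynomial k) • (tautologicalEquiv O x S).symm y := by
    rw [AddEquiv.symm_apply_eq, tautologicalEquiv_X_smul, AddEquiv.apply_symm_apply]
  let W : Submodule k (Surface.ModRel k (O ⊕ S)) :=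
    { N.toAddSubmonoid.comap (tautologicalEquiv O x S).symm with
      smul_mem' a y hy := (congrArg (· ∈ N) (hC a y)).mpr (N.smul_mem _ hy) }
  have he_mem (i : ι) : (tautologicalEquiv O x S).symm (e i) ∈ N := Submodule.subset_span ⟨i, rfl⟩
  have hW : W = ⊤ := he W (fun y (hy : (tautologicalEquiv O x S).symm y ∈ N) =>
    (congrArg (· ∈ N) (hX y)).mpr (N.smul_mem _ hy)) he_mem
  refine eq_top_iff.2 fun y _ => ?_
  have hy : tautologicalEquiv O x S y ∈ W := hW ▸ Submodule.mem_top
  exact hy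

variable {x}
variable {L : Type} [CommRing L] [Algebra k L] [Algebra (Polynomial k) L]
  [IsScalarTower k (Polynomial k) L] {θ : Bool → Lˣ} (hθ : (θ false : L) = -θ true)
  {v : (O → Bool) → L}

/-- The operators of linear combinations of cobordisms, applied to a fixed vector on which `x` acts
as the polynomial variable. -/
def stateSumMap (hv : Surface.transferMap k hθ x v = algebraMap (Polynomial k) L Polynomial.X • v)
    (S : Cob) :
    (fromCob k ⋙ tautological ((fromCob k).obj O) x).obj S →ₗ[Polynomial k] ((S → Bool) → L) where
  toFun y := Surface.transferMap k hθ (tautologicalEquiv O x S y) v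
  map_add' y z := by rw [map_add, map_add, LinearMap.add_apply]
  map_smul' p y := by
    rw [RingHom.id_apply]
    induction p using Polynomial.induction_on' generalizing y with
    | add p q hp hq =>
      rw [add_smul, add_smul, map_add, map_add, LinearMap.add_apply, hp, hq]
    | monomial n a =>
      rw [← Polynomial.C_mul_X_pow_eq_monomial]
      induction n generalizing y with
      | zero =>
        rw [pow_zero, mul_one, tautologicalEquiv_C_smul, map_smul, LinearMap.smul_apply,
          ← algebraMap_smul (Polynomial k) a]
        rfl
      | succ n ih =>
        rw [pow_succ, ← mul_assoc, mul_smul, ih, tautologicalEquiv_X_smul,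
          Surface.transferMap_compModRel, LinearMap.comp_apply, hv, map_smul, algebraMap_smul,
          ← mul_smul]

theorem exists_tqft_iso [Nontrivial k] {h t : Polynomial k} (s : RankTwo.Splitting L h t)
    (hinj : Function.Injective (algebraMap (Polynomial k) L))
    (hv : Surface.transferMap k s.diff_false x v = algebraMap (Polynomial k) L Polynomial.X • v)
    (e : ∀ S : Cob, (S → Fin 2) → Surface.ModRel k (O ⊕ S))
    (he : ∀ (S : Cob) (κ : S → Fin 2), Surface.transferMap k s.diff_false (e S κ) v
      = s.evalTensor S (PiTensorProduct.tprod _ fun b => RankTwo.basis h t (κ b)))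
    (hgen : ∀ S : Cob, Generates O x S (e S)) :
    ∃ F : TQFT (RankTwo.frobenius h t),
      Nonempty (fromCob k ⋙ tautological ((fromCob k).obj O) x ≅ F.functor) := by
  let Ψ := stateSumMap O s.diff_false hv
  choose E hE using fun S : Cob => exists_linearEquiv_comp_eq_of_basis (Ψ S) (s.evalTensor S)
    (s.evalTensor_injective hinj S) (Basis.piTensorProduct fun _ : S => RankTwo.basis h t)
    ((tautologicalEquiv O x S).symm ∘ e S)
    (fun κ => (he S κ).trans (by rw [Basis.piTensorProduct_apply])) (hgen S).span_eq_top
  have hΨ (S : Cob) (y) : s.evalTensor S (E S y) = Ψ S y := LinearMap.congr_fun (hE S) y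
  refine ⟨s.tqft hinj _ E fun S T C y => ?_, ⟨Iso.refl _⟩⟩
  have hC (z) : Ψ T (((fromCob k ⋙ tautological ((fromCob k).obj O) x).map C) z)
      = Surface.transfer s.diff C (Ψ S z) := by
    refine (LinearMap.congr_fun (Surface.transferMap_compModRel s.diff_false
      (tautologicalEquiv O x S z) (Surface.toModRel k C)) v).trans ?_
    rw [LinearMap.comp_apply, Surface.transferMap_toModRel]
    rfl
  refine (hΨ T _).trans ((hC _).trans ?_)
  rw [← hΨ, LinearEquiv.apply_symm_apply]

end CobLoc

namespace Surface

section Recognition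

variable {B K E : Type} [Finite K]

open Classical in
theorem addTube_self (g : K → ℕ) (p : B → K) (i : K) :
    addTube g p i i = of (g + Pi.single i 1) p := by
  have := Fintype.ofFinite K
  symm
  refine of_eq_tubes id (Quot.mk _) Function.surjective_id (fun _ => rfl)
    (fun _ => rfl) (fun _ => rfl) fun φ => ?_
  simp [Pi.single_apply, add_sub_right_comm, mul_add, Finset.sum_add_distrib]

open Classical in
theorem addTube_inr_inl (g : K → ℕ) (p : B → K) (n : ℕ) (i : K) :
    addTube (Sum.elim g fun _ : Unit => n) (fun b => Sum.inl (p b)) (Sum.inr ()) (Sum.inl i)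
      = of (g + Pi.single i n) p := by
  have := Fintype.ofFinite K
  symm
  refine of_eq_tubes (Sum.elim id fun _ => i) (fun k => Quot.mk _ (Sum.inl k))
    (fun k => ⟨Sum.inl k, rfl⟩) (fun _ => rfl) ?_ (fun _ => rfl) fun φ => ?_
  · rintro (k | _)
    · rfl
    · exact (Quot.sound ⟨(), rfl, rfl⟩ : Quot.mk _ (Sum.inr ()) = Quot.mk _ (Sum.inl i)).symm
  · simp only [Fintype.sum_sum_type]
    simp only [Pi.add_apply, Pi.single_apply, Nat.cast_add, Nat.cast_ite, Nat.cast_zero,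
      add_sub_right_comm, mul_add, mul_ite, mul_zero, Finset.sum_add_distrib, Finset.sum_ite_eq',
      Finset.mem_univ, if_true, Sum.elim_inl, Sum.elim_inr, id, Fintype.univ_punit,
      Finset.sum_const, Finset.card_singleton, one_smul]
    ring

theorem addTube_inr_inr (g : K → ℕ) (p : B → K) (n : ℕ) :
    addTube (Sum.elim g fun _ : Unit => n) (fun b => Sum.inl (p b)) (Sum.inr ()) (Sum.inr ())
      = addClosed g p (n + 1) := by
  classical
  rw [addTube_self]
  refine of_eq_of (Equiv.refl _) ?_ fun _ => rfl
  rintro (k | u) <;> simp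

theorem addTube_inl_inl (g : K → ℕ) (p : B → K) (n : ℕ) (i j : K) :
    addTube (Sum.elim g fun _ : Unit => n) (fun b => Sum.inl (p b)) (Sum.inl i) (Sum.inl j)
      = addClosed (tubeGenus g (fun _ : Unit => i) fun _ => j) (fun b => Quot.mk _ (p b)) n :=
  (tubes_addClosed g p _ _ n).symm

theorem of_eq_addClosed (g : K → ℕ) (p : B → K) (k₀ : K) (hp : ∀ b, p b ≠ k₀) :
    of g p = addClosed (fun k : {k // k ≠ k₀} => g k) (fun b => ⟨p b, hp b⟩) (g k₀) := by
  classical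
  refine of_eq_of ((Equiv.optionSubtypeNe k₀).symm.trans (Equiv.optionEquivSumPUnit _))
    (fun k => ?_) fun b => ?_
  · rcases eq_or_ne k k₀ with rfl | hk
    · simp
    · simp [Equiv.optionSubtypeNe_symm_of_ne hk]
  · simp [Equiv.optionSubtypeNe_symm_of_ne (hp b)]

theorem tubes_of_isEmpty [IsEmpty E] (g : K → ℕ) (p : B → K) (s t : E → K) :
    tubes g p s t = of g p := by
  have := Fintype.ofFinite E
  have := Fintype.ofFinite K
  symm
  refine of_eq_tubes id (Quot.mk _) Function.surjective_id (fun e => isEmptyElim e)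
    (fun _ => rfl) (fun _ => rfl) fun φ => ?_
  simp

open Classical in
theorem tubeGenus_add_single [Finite E] (g : K → ℕ) (s t : E → K) (i : K) :
    tubeGenus (g + Pi.single i 1) s t = tubeGenus g s t + Pi.single (Quot.mk _ i) 1 := by
  have := Fintype.ofFinite K
  have := Fintype.ofFinite E
  have := Fintype.ofFinite (TubeComp s t)
  funext q
  have hg := tubeGenus_sum g s t (Pi.single q 1)
  have hg' := tubeGenus_sum (g + Pi.single i 1) s t (Pi.single q 1)
  simp only [Pi.single_apply, Pi.add_apply, Nat.cast_add, Nat.cast_ite, Nat.cast_one,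
    Nat.cast_zero, add_sub_right_comm, mul_add, mul_ite, ite_mul, one_mul, zero_mul, mul_one,
    mul_zero, Finset.sum_add_distrib, Finset.sum_ite_eq', Finset.mem_univ, if_true] at hg hg' ⊢
  split_ifs at hg' ⊢ <;> grind

variable [Finite E]

open Classical in
theorem tubes_update (g : K → ℕ) (p : B → K) (s t : E → K) (e₀ : E) (i j : K) :
    tubes g p (Function.update s e₀ i) (Function.update t e₀ j)
      = addTube (tubeGenus g (fun e : {e // e ≠ e₀} => s e) fun e => t e)
          (fun b => Quot.mk _ (p b)) (Quot.mk _ i) (Quot.mk _ j) := by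
  refine Eq.trans ?_ (tubes_tubes g _ _ p (fun _ : Unit => i) fun _ => j).symm
  refine (tubes_congr (Equiv.refl K) ((Equiv.optionEquivSumPUnit _).symm.trans
    (Equiv.optionSubtypeNe e₀)) (fun _ => rfl) (fun _ => rfl) ?_ ?_).symm <;>
    exact Sum.rec (fun e => by simp [e.2]) fun _ => by simp

theorem tubes_eq_addTube (g : K → ℕ) (p : B → K) (s t : E → K) (e₀ : E) :
    tubes g p s t
      = addTube (tubeGenus g (fun e : {e // e ≠ e₀} => s e) fun e => t e)
          (fun b => Quot.mk _ (p b)) (Quot.mk _ (s e₀)) (Quot.mk _ (t e₀)) := by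
  classical
  simpa using tubes_update g p s t e₀ (s e₀) (t e₀)

theorem of_eq_tubes_discs [Finite B] (g : K → ℕ) (p : B → K) :
    of g p = tubes (Sum.elim (fun _ : B => 0) g) Sum.inl (fun b : B => Sum.inl b)
      fun b : B => Sum.inr (p b) := by
  have := Fintype.ofFinite B
  have := Fintype.ofFinite K
  refine of_eq_tubes (Sum.elim p id) (fun k => Quot.mk _ (Sum.inr k))
    (fun k => ⟨Sum.inr k, rfl⟩) (fun _ => rfl) ?_ (fun _ => rfl) fun φ => ?_
  · rintro (b | k)
    · exact (Quot.sound ⟨b, rfl, rfl⟩ : Quot.mk _ (Sum.inl b) = Quot.mk _ (Sum.inr (p b))).symm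
    · rfl
  · simp only [Fintype.sum_sum_type]
    simp

theorem of_eq_tubes_spheres [Finite B] (g : K → ℕ) (p : B → K) :
    of g p = tubes (fun _ : B ⊕ K => 0) Sum.inl
      (Sum.elim (fun b : B => Sum.inl b) fun e : (Σ k, Fin (g k)) => Sum.inr e.1)
      (Sum.elim (fun b : B => Sum.inr (p b)) fun e : (Σ k, Fin (g k)) => Sum.inr e.1) := by
  have := Fintype.ofFinite B
  have := Fintype.ofFinite K
  refine of_eq_tubes (Sum.elim p id) (fun k => Quot.mk _ (Sum.inr k))
    (fun k => ⟨Sum.inr k, rfl⟩) ?_ ?_ (fun _ => rfl) fun φ => ?_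
  · rintro (b | e) <;> rfl
  · rintro (b | k)
    · exact (Quot.sound ⟨Sum.inl b, rfl, rfl⟩ :
        Quot.mk _ (Sum.inl b) = Quot.mk _ (Sum.inr (p b))).symm
    · rfl
  · simp only [Fintype.sum_sum_type, Fintype.sum_sigma]
    simp only [mul_sub, mul_one, Finset.sum_sub_distrib, Sum.elim_inl, Sum.elim_inr, id,
      Nat.cast_zero, zero_sub, mul_neg, Finset.sum_neg_distrib, Finset.sum_const, Finset.card_univ,
      Fintype.card_fin, nsmul_eq_mul, mul_comm]
    ring

open Classical in
theorem tubes_const_of_injective (p : B → K) {s : E → K} (hs : Function.Injective s) {i : K}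
    (hi : i ∉ Set.range s) :
    tubes (fun _ => 0) p s (fun _ => i)
      = of (fun _ : {k // k ∉ Set.range s} => 0)
          fun b => if h : p b ∈ Set.range s then ⟨i, hi⟩ else ⟨p b, h⟩ := by
  have := Fintype.ofFinite K
  have := Fintype.ofFinite E
  symm
  refine of_eq_tubes (fun k => if h : k ∈ Set.range s then ⟨i, hi⟩ else ⟨k, h⟩)
    (fun k => Quot.mk _ k.1) (fun k => ⟨k, dif_neg k.2⟩) (fun e => ?_) (fun k => ?_)
    (fun _ => by congr) fun φ => ?_
  · rw [dif_pos ⟨e, rfl⟩, dif_neg hi]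
  · split_ifs with hk
    · obtain ⟨e, rfl⟩ := hk
      exact (Quot.sound ⟨e, rfl, rfl⟩ : Quot.mk _ (s e) = Quot.mk _ i).symm
    · rfl
  · rw [← Fintype.sum_subtype_add_sum_subtype (· ∈ Set.range s)]
    have hin (k : {k // k ∈ Set.range s}) : (if h : k.1 ∈ Set.range s then
        (⟨i, hi⟩ : {k // k ∉ Set.range s}) else ⟨k.1, h⟩) = ⟨i, hi⟩ := dif_pos k.2
    have hout (k : {k // k ∉ Set.range s}) : (if h : k.1 ∈ Set.range s then
        (⟨i, hi⟩ : {k // k ∉ Set.range s}) else ⟨k.1, h⟩) = k := dif_neg k.2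
    have hcard : Nat.card {k // k ∈ Set.range s} = Nat.card E :=
      Nat.card_congr (Equiv.ofInjective s hs).symm
    simp only [hin, hout, dif_pos (Set.mem_range_self _), Finset.sum_const, Finset.card_univ,
      ← Nat.card_eq_fintype_card, nsmul_eq_mul]
    rw [hcard]
    ring

end Recognition

section Relations

variable {k : Type} [CommRing k] {B K : Type} [Finite K]

theorem toModRel_fourTu (g : K → ℕ) (p : B → K) (a b c d : K) :
    toModRel k (addTube g p a b) + toModRel k (addTube g p c d)
      = toModRel k (addTube g p a c) + toModRel k (addTube g p b d) := by
  have h := (Submodule.Quotient.mk_eq_zero (localRel k B)).2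
    (Submodule.subset_span (IsLocalRel.fourTu (k := k) g p ![a, b, c, d]))
  simp only [Submodule.Quotient.mk_sub, Submodule.Quotient.mk_add] at h
  rw [← sub_eq_zero, ← h]
  simp only [toModRel, Matrix.cons_val]
  abel

theorem toModRel_addClosed_zero (g : K → ℕ) (p : B → K) : toModRel k (addClosed g p 0) = 0 :=
  (Submodule.Quotient.mk_eq_zero (localRel k B)).2
    (Submodule.subset_span (IsLocalRel.sphere g p))

theorem toModRel_addClosed_one (g : K → ℕ) (p : B → K) :
    toModRel k (addClosed g p 1) = (2 : k) • toModRel k (of g p) := by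
  have h := (Submodule.Quotient.mk_eq_zero (localRel k B)).2
    (Submodule.subset_span (IsLocalRel.torus (k := k) g p))
  rw [Submodule.Quotient.mk_sub, sub_eq_zero] at h
  rw [toModRel, h, toModRel, ← Submodule.Quotient.mk_smul, Finsupp.smul_single_one]

open Classical in
/-- 4TU with two of the four discs on an additional closed component. -/
theorem toModRel_addClosed_succ_add (g : K → ℕ) (p : B → K) (i j : K) (n : ℕ) :
    toModRel k (addClosed g p (n + 1))
        + toModRel k (addClosed (tubeGenus g (fun _ : Unit => i) fun _ => j)
            (fun b => Quot.mk _ (p b)) n)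
      = toModRel k (of (g + Pi.single i n) p) + toModRel k (of (g + Pi.single j n) p) := by
  have h := toModRel_fourTu (k := k) (Sum.elim g fun _ : Unit => n) (fun b => Sum.inl (p b))
    (Sum.inr ()) (Sum.inr ()) (Sum.inl i) (Sum.inl j)
  rwa [addTube_inr_inr, addTube_inl_inl, addTube_inr_inl, addTube_inr_inl] at h

theorem toModRel_addClosed_two [Nonempty K] (g : K → ℕ) (p : B → K) :
    toModRel k (addClosed g p 2) = 0 := by
  obtain ⟨i⟩ := ‹Nonempty K›
  have h := toModRel_addClosed_succ_add (k := k) g p i i 1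
  rw [toModRel_addClosed_one, ← addTube_self, two_smul] at h
  exact add_eq_right.1 h

theorem two_smul_toModRel_addTube (g : K → ℕ) (p : B → K) (i j : K) :
    (2 : k) • toModRel k (addTube g p i j)
      = toModRel k (addTube g p i i) + toModRel k (addTube g p j j) := by
  have : Nonempty K := ⟨i⟩
  have h := toModRel_addClosed_succ_add (k := k) g p i j 1
  rw [toModRel_addClosed_two, zero_add, toModRel_addClosed_one] at h
  rw [addTube_self, addTube_self, ← h, addTube, tubes]

open Classical in
theorem toModRel_addClosed_three (g : K → ℕ) (p : B → K) (i : K) :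
    toModRel k (addClosed g p 3) = (2 : k) • toModRel k (of (g + Pi.single i 2) p) := by
  have h := toModRel_addClosed_succ_add (k := k) g p i i 2
  have : Nonempty (TubeComp (fun _ : Unit => i) fun _ => i) := ⟨Quot.mk _ i⟩
  rwa [toModRel_addClosed_two, add_zero, ← two_smul k] at h

theorem toModRel_of_eq_zero (g : K → ℕ) (p : B → K) (k₀ : K) (hp : ∀ b, p b ≠ k₀)
    (hk₀ : g k₀ = 0) : toModRel k (of g p) = 0 := by
  rw [of_eq_addClosed g p k₀ hp, hk₀, toModRel_addClosed_zero]

open Classical in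
/-- 4TU moves one end of a tube to any other component `i`. -/
theorem toModRel_tubes_eq {E : Type} [Finite E] (g : K → ℕ) (p : B → K) (s t : E → K) (e₀ : E)
    (i : K) :
    toModRel k (tubes g p s t)
      = toModRel k (tubes g p s (Function.update t e₀ i))
        + toModRel k (tubes g p (Function.update s e₀ (t e₀)) (Function.update t e₀ i))
        - toModRel k (tubes g p (Function.update s e₀ i) (Function.update t e₀ i)) := by
  have h := toModRel_fourTu (k := k) (tubeGenus g (fun e : {e // e ≠ e₀} => s e) fun e => t e)
    (fun b => Quot.mk _ (p b)) (Quot.mk _ (s e₀)) (Quot.mk _ (t e₀)) (Quot.mk _ i) (Quot.mk _ i)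
  simp only [← tubes_update, Function.update_eq_self] at h
  exact eq_sub_of_add_eq h

end Relations

end Surface

namespace Surface

section SpanningDiscs

variable {k : Type} [CommRing k] [Invertible (2 : k)] {B : Type} {W : Submodule k (ModRel k B)}

theorem toModRel_tubes_mem {K : Type} [Finite K] {p : B → K}
    (h : ∀ g : K → ℕ, toModRel k (of g p) ∈ W) {E : Type} [Finite E] (g : K → ℕ)
    (s t : E → K) : toModRel k (tubes g p s t) ∈ W := by
  classical
  induction hn : Nat.card E using Nat.strong_induction_on generalizing E g with | h n ih
  rcases isEmpty_or_nonempty E with _ | ⟨⟨e₀⟩⟩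
  · rw [tubes_of_isEmpty]
    exact h g
  have hcap (i : K) : toModRel k (addTube (tubeGenus g (fun e : {e // e ≠ e₀} => s e)
      fun e => t e) (fun b => Quot.mk _ (p b)) (Quot.mk _ i) (Quot.mk _ i)) ∈ W := by
    rw [addTube_self, ← tubeGenus_add_single]
    exact ih _ (hn ▸ Finite.card_subtype_lt (not_not.2 rfl)) (g + Pi.single i 1)
      (fun e : {e // e ≠ e₀} => s e) (fun e => t e) rfl
  rw [tubes_eq_addTube g p s t e₀, ← Submodule.smul_mem_iff'' (r := (2 : k)),
    two_smul_toModRel_addTube]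
  exact W.add_mem (hcap _) (hcap _)

variable
  (hW : ∀ {K : Type} [Finite K] (g : K → ℕ) (p : B → K),
    toModRel k (of g p) ∈ W → toModRel k (addClosed g p 3) ∈ W)

include hW

theorem toModRel_of_mem_of_forall_le_one {K : Type} [Finite K] {p : B → K}
    (h : ∀ g : K → ℕ, (∀ i, g i ≤ 1) → toModRel k (of g p) ∈ W) (g : K → ℕ) :
    toModRel k (of g p) ∈ W := by
  classical
  induction g using WellFoundedLT.induction with | ind g ih
  by_cases hg : ∀ i, g i ≤ 1
  · exact h g hg
  push Not at hg
  obtain ⟨i, hi⟩ := hg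
  have hsplit : g - Pi.single i 2 + Pi.single i 2 = g := by
    refine tsub_add_cancel_of_le fun j => ?_
    rcases eq_or_ne j i with rfl | hj
    · simpa using Nat.succ_le_of_lt hi
    · simp [hj]
  have hlt : g - Pi.single i 2 < g := by
    conv_rhs => rw [← hsplit]
    exact lt_add_of_pos_right _ (by simp)
  have := hW _ _ (ih _ hlt)
  rwa [toModRel_addClosed_three _ _ i, hsplit, Submodule.smul_mem_iff''] at this

variable [Finite B] (hdisc : ∀ g : B → ℕ, (∀ b, g b ≤ 1) → toModRel k (of g id) ∈ W)

include hdisc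

theorem toModRel_of_mem_of_injective {K : Type} [Finite K] (g : K → ℕ) {p : B → K}
    (hp : Function.Injective p) : toModRel k (of g p) ∈ W := by
  induction hn : Nat.card K using Nat.strong_induction_on generalizing K with | h n ih
  refine toModRel_of_mem_of_forall_le_one hW (fun g hg => ?_) g
  by_cases hsurj : Function.Surjective p
  · have hid : of (g ∘ p) id = of g p :=
      of_eq_of (Equiv.ofBijective p ⟨hp, hsurj⟩) (fun _ => rfl) fun _ => rfl
    rw [← hid]
    exact hdisc _ fun b => hg (p b)
  simp only [Function.Surjective, not_forall, not_exists] at hsurj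
  obtain ⟨i, hi⟩ := hsurj
  rw [of_eq_addClosed g p i hi]
  rcases Nat.le_one_iff_eq_zero_or_eq_one.1 (hg i) with hgi | hgi
  · rw [hgi, toModRel_addClosed_zero]
    exact W.zero_mem
  · rw [hgi, toModRel_addClosed_one]
    exact W.smul_mem _ <| ih _ (hn ▸ Finite.card_subtype_lt (not_not.2 rfl)) _
      (fun b b' h => hp (congrArg Subtype.val h)) rfl

theorem eq_top_of_discs : W = ⊤ := by
  refine eq_top_iff.2 fun x _ => modRel_induction x (fun C => ?_) (fun _ _ => W.add_mem)
    (fun c _ => W.smul_mem c) W.zero_mem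
  obtain ⟨n, g, p, rfl⟩ := exists_of C
  rw [of_eq_tubes_discs]
  exact toModRel_tubes_mem
    (fun g => toModRel_of_mem_of_injective hW hdisc g Sum.inl_injective) _ _ _

end SpanningDiscs

section SpanningStars

variable {k : Type} [CommRing k] {B : Type} {W : Submodule k (ModRel k B)}

theorem toModRel_tubes_mem_of_const {K E : Type} [Finite K] [Finite E] {g : K → ℕ} {p : B → K}
    {i : K} (h : ∀ s : E → K, toModRel k (tubes g p s fun _ => i) ∈ W) (s t : E → K) :
    toModRel k (tubes g p s t) ∈ W := by
  classical
  have := Fintype.ofFinite E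
  suffices ∀ (F : Finset E) (s t : E → K), (∀ e ∉ F, t e = i) →
      toModRel k (tubes g p s t) ∈ W from this Finset.univ s t (by simp)
  intro F
  induction F using Finset.induction_on with
  | empty =>
    intro s t ht
    rw [funext fun e => ht e (Finset.notMem_empty e)]
    exact h s
  | insert e₀ F _ ih =>
    intro s t ht
    have ht' : ∀ e ∉ F, Function.update t e₀ i e = i := fun e he => by
      rcases eq_or_ne e e₀ with rfl | hne
      · exact Function.update_self ..
      · rw [Function.update_of_ne hne, ht e (by simp [hne, he])]
    rw [toModRel_tubes_eq g p s t e₀ i]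
    exact W.sub_mem (W.add_mem (ih _ _ ht') (ih _ _ ht')) (ih _ _ ht')

variable {b₀ : B}
  (hW : ∀ {K : Type} [Finite K] (g : K → ℕ) (p : B → K),
    toModRel k (of g p) ∈ W → toModRel k (addTube g p (p b₀) (p b₀)) ∈ W)
  (hstar : ∀ {K : Type} [Finite K] (p : B → K), Function.Surjective p →
    (∀ b b', p b = p b' → b = b' ∨ p b = p b₀) → toModRel k (of (fun _ => 0) p) ∈ W)

include hstar in
theorem toModRel_tubes_mem_of_injective {K E : Type} [Finite K] [Finite E] {p : B → K}
    (hp : Function.Injective p) {s : E → K} (hs : Function.Injective s)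
    (hb₀ : p b₀ ∉ Set.range s) :
    toModRel k (tubes (fun _ => 0) p s fun _ => p b₀) ∈ W := by
  classical
  rw [tubes_const_of_injective p hs hb₀]
  set p' : B → {k // k ∉ Set.range s} := fun b => if h : p b ∈ Set.range s then ⟨p b₀, hb₀⟩
    else ⟨p b, h⟩ with hp'
  by_cases hsurj : Function.Surjective p'
  · refine hstar p' hsurj fun b b' h => ?_
    simp only [hp', dif_neg hb₀] at h ⊢
    split_ifs at h ⊢ <;> grind
  · simp only [Function.Surjective, not_forall, not_exists] at hsurj
    obtain ⟨i, hi⟩ := hsurj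
    rw [toModRel_of_eq_zero _ p' i hi rfl]
    exact W.zero_mem

include hW hstar in
theorem toModRel_tubes_const_mem {K : Type} [Finite K] {p : B → K} (hp : Function.Injective p)
    {E : Type} [Finite E] (s : E → K) :
    toModRel k (tubes (fun _ => 0) p s fun _ => p b₀) ∈ W := by
  induction hn : Nat.card E using Nat.strong_induction_on generalizing E with | h n ih
  by_cases hs : Function.Injective s ∧ p b₀ ∉ Set.range s
  · exact toModRel_tubes_mem_of_injective hstar hp hs.1 hs.2
  obtain ⟨e₀, he₀⟩ : ∃ e₀, (Quot.mk _ (s e₀) : TubeComp (fun e : {e // e ≠ e₀} => s e)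
      fun _ => p b₀) = Quot.mk _ (p b₀) := by
    simp only [Function.Injective, Set.mem_range, not_and_or, not_forall, not_not] at hs
    rcases hs with ⟨e, e', hee', hne⟩ | ⟨e, he⟩
    · exact ⟨e, Quot.sound ⟨⟨e', Ne.symm hne⟩, hee'.symm, rfl⟩⟩
    · exact ⟨e, congrArg _ he⟩
  rw [tubes_eq_addTube _ _ _ _ e₀, he₀]
  exact hW _ _ (ih _ (hn ▸ Finite.card_subtype_lt (not_not.2 rfl)) (fun e : {e // e ≠ e₀} => s e)
    rfl)

include hW hstar in
theorem eq_top_of_stars [Finite B] : W = ⊤ := by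
  refine eq_top_iff.2 fun x _ => modRel_induction x (fun C => ?_) (fun _ _ => W.add_mem)
    (fun c _ => W.smul_mem c) W.zero_mem
  obtain ⟨n, g, p, rfl⟩ := exists_of C
  rw [of_eq_tubes_spheres]
  exact toModRel_tubes_mem_of_const
    (toModRel_tubes_const_mem hW hstar Sum.inl_injective) _ _

end SpanningStars

end Surface

namespace RankTwo

namespace Splitting

variable {R L : Type} [CommRing R] [CommRing L] [Algebra R L] {h t : R}

/-- The splitting with given roots. -/
def ofRoots (a b : L) (hunit : IsUnit (a - b)) (hadd : a + b = algebraMap R L h)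
    (hmul : a * b = -algebraMap R L t) : Splitting L h t where
  root c := if c then a else b
  diff c := if c then hunit.unit else -hunit.unit
  diff_eq c := by cases c <;> simp
  root_add := hadd
  root_mul := hmul

theorem evalTensor_tprod_basis [Nontrivial R] (s : Splitting L h t) {S : Type} [Fintype S]
    (κ : S → Fin 2) (τ : S → Bool) :
    s.evalTensor S (PiTensorProduct.tprod R fun b => basis h t (κ b)) τ
      = ∏ b, s.root (τ b) ^ (κ b : ℕ) := by
  rw [evalTensor_tprod]
  refine Finset.prod_congr rfl fun b _ => ?_
  generalize κ b = i
  fin_cases i <;> simp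

end Splitting

variable {R : Type} [CommRing R]

/-- The splitting of `X² - h X` with the roots `h` and `0`. -/
def splittingOfRegular {h : R} (hh : h ∈ nonZeroDivisors R) : Splitting (FractionRing R) h 0 :=
  .ofRoots (algebraMap R _ h) 0
    (by simpa using IsLocalization.map_units (FractionRing R) ⟨h, hh⟩) (by simp) (by simp)

theorem smul_eq_zero_of_mem_nonZeroDivisors [Nontrivial R] (h t : R) {a : R}
    (ha : a ∈ nonZeroDivisors R) {y : Alg h t} (hy : a • y = 0) : y = 0 := by
  refine (basis h t).ext_elem fun i => ?_
  have hrepr := congrArg (fun z => (basis h t).repr z i) hy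
  simp only [map_smul, map_zero, Finsupp.smul_apply, Finsupp.zero_apply, smul_eq_mul] at hrepr ⊢
  exact (mul_left_mem_nonZeroDivisors_eq_zero_iff ha).1 hrepr

theorem x_mem_nonZeroDivisors [Nontrivial R] {t : R} (ht : t ∈ nonZeroDivisors R) :
    x 0 t ∈ nonZeroDivisors (Alg 0 t) := by
  refine mem_nonZeroDivisors_iff_right.2 fun y hy => ?_
  refine smul_eq_zero_of_mem_nonZeroDivisors 0 t ht ?_
  calc t • y = y * x 0 t * x 0 t := by
        rw [mul_assoc, x_mul_x, zero_smul, zero_add, mul_smul_comm, mul_one]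
    _ = 0 := by rw [hy, zero_mul]

theorem algebraMap_fractionRing_injective [Nontrivial R] (h t : R) :
    Function.Injective (algebraMap R (FractionRing (Alg h t))) := by
  have : Module.Free R (Alg h t) := .of_basis (basis h t)
  have : Nontrivial (Alg h t) := nontrivial_of_ne _ _ ((basis h t).ne_zero 0)
  rw [IsScalarTower.algebraMap_eq R (Alg h t)]
  exact (IsFractionRing.injective (Alg h t) _).comp (FaithfulSMul.algebraMap_injective R _)

/-- The splitting of `X² - t` with the tautological roots `x` and `-x`. -/
def splittingTautological [Nontrivial R] [Invertible (2 : R)] {t : R}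
    (ht : t ∈ nonZeroDivisors R) : Splitting (FractionRing (Alg 0 t)) 0 t :=
  .ofRoots (algebraMap _ _ (x 0 t)) (-algebraMap _ _ (x 0 t))
    (by
      have htwo : IsUnit (algebraMap R (FractionRing (Alg 0 t)) 2) :=
        (isUnit_of_invertible 2).map _
      rw [sub_neg_eq_add, ← two_mul, ← map_ofNat (algebraMap R (FractionRing (Alg 0 t))) 2]
      exact htwo.mul (IsLocalization.map_units _ ⟨_, x_mem_nonZeroDivisors ht⟩))
    (by simp)
    (by
      rw [mul_neg, ← map_mul, x_mul_x, zero_smul, zero_add, ← Algebra.algebraMap_eq_smul_one,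
        ← IsScalarTower.algebraMap_apply])

end RankTwo

namespace Surface

open Classical in
theorem stateSum_of_id {Q L K : Type} [Fintype Q] [CommRing L] (θ : Q → Lˣ) [Fintype K]
    (g : K → ℕ) (σ : K → Q) :
    stateSum θ (of g id) σ = ((∏ k, θ (σ k) ^ ((g k : ℤ) - 1) : Lˣ) : L) := by
  rw [stateSum_of]
  exact (Fintype.sum_eq_single σ fun c hc => if_neg hc).trans (if_pos rfl)

open Classical in
theorem stateSum_tubes_id {Q L K E : Type} [Fintype Q] [CommRing L] (θ : Q → Lˣ) [Fintype K]
    [Fintype E] (g : K → ℕ) (s t : E → K) (σ : K → Q) :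
    stateSum θ (tubes g id s t) σ
      = if σ ∘ s = σ ∘ t then
          ((∏ k, θ (σ k) ^ ((g k : ℤ) - 1) : Lˣ) : L) * ((∏ e, θ (σ (s e)) : Lˣ) : L) else 0 := by
  rw [stateSum_tubes]
  refine (Fintype.sum_eq_single σ fun c hc => if_neg fun h => hc h.1).trans ?_
  simp only [Function.comp_id, true_and]

section Star

theorem comp_connected_one {S K : Type} [Finite K] (g : K → ℕ) (p : Unit ⊕ S → K) :
    comp (connected (Unit ⊕ Unit) 1) (of g p) = addTube g p (p (Sum.inl ())) (p (Sum.inl ())) := by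
  classical
  have := Fintype.ofFinite K
  rw [connected, comp_of, addTube_self]
  symm
  refine of_eq_tubes (Sum.elim (fun _ => p (Sum.inl ())) id) (fun k => Quot.mk _ (Sum.inr k))
    (fun k => ⟨Sum.inr k, rfl⟩) (fun _ => rfl) ?_ ?_ fun φ => ?_
  · rintro (u | k)
    · exact (Quot.sound ⟨(), rfl, rfl⟩ :
        Quot.mk _ (Sum.inl u) = Quot.mk _ (Sum.inr (p (Sum.inl ())))).symm
    · rfl
  · rintro (b | b) <;> rfl
  · simp only [Fintype.sum_sum_type]
    simp [Pi.single_apply, add_sub_right_comm, mul_add, Finset.sum_add_distrib, add_comm]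

variable {S : Type}

/-- The surface of genus `0` with one component that contains the special circle and the circles in
`κ⁻¹(1)`, the other circles bounding discs. -/
def star [Finite S] (κ : S → Fin 2) : Surface (Unit ⊕ S) :=
  tubes (fun _ => 0) id (fun b : {b // κ b = 1} => Sum.inr b.1) fun _ => Sum.inl ()

open Classical in
theorem of_eq_star [Finite S] {K : Type} [Finite K] {p : Unit ⊕ S → K}
    (hp : Function.Surjective p)
    (hp' : ∀ b b', p b = p b' → b = b' ∨ p b = p (Sum.inl ())) :
    of (fun _ => 0) p = star fun b => if p (Sum.inr b) = p (Sum.inl ()) then 1 else 0 := by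
  set κ : S → Fin 2 := fun b => if p (Sum.inr b) = p (Sum.inl ()) then 1 else 0
  have hκ (b : S) : κ b = 1 ↔ p (Sum.inr b) = p (Sum.inl ()) := by simp [κ]
  set s : {b // κ b = 1} → Unit ⊕ S := fun b => Sum.inr b.1
  have hrange (b : Unit ⊕ S) : b ∉ Set.range s ↔ p b = p (Sum.inl ()) → b = Sum.inl () := by
    rcases b with b | b <;> simp [s, hκ]
  have hbij : Function.Bijective fun b : {b // b ∉ Set.range s} => p b := by
    refine ⟨fun b b' h => Subtype.ext ?_, fun i => ?_⟩
    · have := (hrange b).1 b.2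
      have := (hrange b').1 b'.2
      grind
    · obtain ⟨b, rfl⟩ := hp i
      by_cases hb : b ∈ Set.range s
      · refine ⟨⟨Sum.inl (), by simp [s]⟩, ?_⟩
        obtain ⟨b, rfl⟩ := hb
        exact ((hκ b).1 b.2).symm
      · exact ⟨⟨b, hb⟩, rfl⟩
  rw [star, tubes_const_of_injective id (s := s) (Sum.inr_injective.comp Subtype.val_injective)
    (by simp [s])]
  refine (of_eq_of (Equiv.ofBijective _ hbij) (fun _ => rfl) fun b => ?_).symm
  simp only [id, Equiv.ofBijective_apply]
  split_ifs with hb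
  · obtain ⟨b, rfl⟩ := hb
    exact (hκ b).1 b.2
  · rfl

open Classical in
theorem transfer_star {Q L : Type} [Fintype Q] [CommRing L] (θ : Q → Lˣ) [Finite S]
    (κ : S → Fin 2) [Fintype {b // κ b = 1}] (f : (Unit → Q) → L) (τ : S → Q) :
    transfer θ (star κ) f τ
      = ∑ a, ((θ a)⁻¹ : Lˣ) * f (fun _ => a)
          * ∏ b : {b // κ b = 1}, if τ b = a then (θ a : L) else 0 := by
  have := Fintype.ofFinite S
  rw [transfer_apply, ← (Equiv.funUnique Unit Q).symm.sum_comp, Finset.mul_sum]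
  refine Finset.sum_congr rfl fun a _ => ?_
  let σ : Unit ⊕ S → Q := Sum.elim (fun _ => a) τ
  change ((∏ b, θ (τ b) : Lˣ) : L) * (stateSum θ (star κ) σ * f fun _ => a) = _
  rw [star, stateSum_tubes_id, Finset.prod_ite_zero]
  have hglue : ((σ ∘ fun b : {b // κ b = 1} => Sum.inr b.1) = σ ∘ fun _ => Sum.inl ())
      ↔ ∀ b : {b // κ b = 1}, τ b = a := funext_iff
  by_cases hτ : ∀ e : {b // κ b = 1}, τ e = a
  · have hweight : (∏ b, θ (τ b)) * ((∏ i, θ (σ i) ^ (((0 : ℕ) : ℤ) - 1))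
        * ∏ b : {b // κ b = 1}, θ (σ (Sum.inr b.1))) = (θ a)⁻¹ * ∏ _b : {b // κ b = 1}, θ a := by
      simp only [σ, Fintype.prod_sum_type, Sum.elim_inl, Sum.elim_inr, hτ, Nat.cast_zero, zero_sub,
        zpow_neg_one, Finset.prod_inv_distrib, Finset.univ_unique, Finset.prod_singleton]
      rw [mul_left_comm, mul_inv, mul_assoc, inv_mul_cancel_left]
    rw [if_pos (hglue.2 hτ), if_pos fun b _ => hτ b, ← Units.val_mul, ← mul_assoc, ← Units.val_mul,
      hweight, Units.val_mul, Units.coe_prod, mul_right_comm]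
  · rw [if_neg fun h => hτ (hglue.1 h), if_neg fun h => hτ fun e => h e (Finset.mem_univ e)]
    simp only [zero_mul, mul_zero]

theorem eq_top_of_star {k : Type} [CommRing k] [Finite S] {W : Submodule k (ModRel k (Unit ⊕ S))}
    (hW : ∀ y ∈ W, compModRel k Unit Unit S (toModRel k (connected (Unit ⊕ Unit) 1)) y ∈ W)
    (hstar : ∀ κ : S → Fin 2, toModRel k (star κ) ∈ W) : W = ⊤ := by
  classical
  refine eq_top_of_stars (b₀ := Sum.inl ()) (fun g p hp => ?_) fun p hp hp' => ?_
  · rw [← comp_connected_one, ← compModRel_toModRel]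
    exact hW _ hp
  · rw [of_eq_star hp hp']
    exact hstar _

end Star

section Discs

theorem comp_connected_empty {S K : Type} [Finite K] (n : ℕ) (g : K → ℕ) (p : Empty ⊕ S → K) :
    comp (connected (Empty ⊕ Empty) n) (of g p) = addClosed g p n := by
  rw [connected, comp_of, tubes_of_isEmpty]
  refine of_eq_of (Equiv.sumComm _ _) ?_ ?_
  · rintro (u | k) <;> rfl
  · rintro (b | b)
    · exact b.elim
    · rfl

/-- The discs that bound the circles of `S`, with `g b` handles on the disc that bounds `b`. -/
def discs {S : Type} [Finite S] (g : S → ℕ) : Surface (Empty ⊕ S) :=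
  of (Sum.elim Empty.elim g) id

theorem transfer_discs {Q L : Type} [Fintype Q] [CommRing L] (θ : Q → Lˣ) {S : Type} [Fintype S]
    (g : S → ℕ) (f : (Empty → Q) → L) (τ : S → Q) :
    transfer θ (discs g) f τ = f Empty.elim * ∏ b, (θ (τ b) : L) ^ g b := by
  classical
  rw [transfer_apply, Fintype.sum_unique, discs, stateSum_of_id]
  simp only [Fintype.prod_sum_type, Finset.univ_eq_empty, Finset.prod_empty, one_mul, Sum.elim_inr]
  rw [← mul_assoc, ← Units.val_mul, ← Finset.prod_mul_distrib, mul_comm,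
    Unique.default_eq Empty.elim, Units.coe_prod]
  refine congrArg _ (Finset.prod_congr rfl fun b _ => ?_)
  rw [zpow_sub_one, mul_comm, inv_mul_cancel_right, zpow_natCast, Units.val_pow_eq_pow_val]

/-- The discs that bound the circles of `S`, with a handle on each disc whose label is `1`, divided
by two for each handle. -/
def halfHandleDiscs (k : Type) [CommRing k] [Invertible (2 : k)] {S : Type} [Finite S]
    (κ : S → Fin 2) : ModRel k (Empty ⊕ S) :=
  (⅟2 : k) ^ (∑ᶠ b, (κ b : ℕ)) • toModRel k (discs fun b => (κ b : ℕ))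

theorem eq_top_of_halfHandleDiscs {k : Type} [CommRing k] [Invertible (2 : k)] {S : Type}
    [Finite S] {W : Submodule k (ModRel k (Empty ⊕ S))} {u : k} (hu : IsUnit u)
    (hW : ∀ y ∈ W, compModRel k Empty Empty S (u • toModRel k (connected (Empty ⊕ Empty) 3)) y ∈ W)
    (hdiscs : ∀ κ : S → Fin 2, halfHandleDiscs k κ ∈ W) : W = ⊤ := by
  refine eq_top_of_discs (fun g p hp => ?_) fun g hg => ?_
  · rw [← comp_connected_empty, ← compModRel_toModRel, ← W.smul_mem_iff_of_isUnit hu,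
      ← LinearMap.smul_apply, ← map_smul]
    exact hW _ hp
  · have hg' : g = Sum.elim Empty.elim fun b => g (Sum.inr b) := by
      rw [← Unique.default_eq Empty.elim, ← Unique.eq_default (g ∘ Sum.inl)]
      exact (Sum.elim_comp_inl_inr g).symm
    rw [hg']
    exact (W.smul_mem_iff_of_isUnit ((isUnit_of_invertible _).pow _)).1
      (hdiscs fun b => ⟨g (Sum.inr b), Nat.lt_succ_of_le (hg _)⟩)

end Discs

end Surface

namespace RankTwo.Splitting

section Circle

variable {R L : Type} [CommRing R] [CommRing L] [Algebra R L] {h : R} (s : Splitting L h 0)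

theorem transfer_star_root [Nontrivial R] (hs : s.root false = 0) {S : Type} [Finite S]
    (κ : S → Fin 2) :
    Surface.transfer s.diff (Surface.star κ) (fun σ => s.root (σ ()))
      = s.evalTensor S (PiTensorProduct.tprod _ fun b => basis h 0 (κ b)) := by
  classical
  have := Fintype.ofFinite S
  have htrue : (s.diff true : L) = s.root true := by rw [s.diff_eq, Bool.not_true, hs, sub_zero]
  funext τ
  rw [Surface.transfer_star, s.evalTensor_tprod_basis, Fintype.sum_bool, hs, mul_zero, zero_mul,
    add_zero, ← htrue, Units.inv_mul, one_mul, htrue,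
    ← Fintype.prod_subtype_mul_prod_subtype (fun b => κ b = 1),
    Fintype.prod_eq_one (fun b : {b // κ b ≠ 1} => s.root (τ b) ^ (κ b : ℕ)) fun b => ?_, mul_one]
  · refine Fintype.prod_congr _ _ fun b => ?_
    rw [b.2, Fin.val_one, pow_one]
    cases τ b
    · rw [if_neg Bool.false_ne_true, hs]
    · exact if_pos rfl
  · rw [(Fin.exists_fin_two.1 ⟨_, rfl⟩).resolve_right b.2, Fin.val_zero, pow_zero]

theorem transfer_handle_root (hs : s.root false = 0) :
    Surface.transfer s.diff (Surface.connected (Unit ⊕ Unit) 1) (fun σ => s.root (σ ()))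
      = algebraMap R L h • fun σ => s.root (σ ()) := by
  funext τ
  have hτ : τ = fun _ => τ () := rfl
  rw [Surface.transfer_connected_of_mem _ (), if_pos hτ, Pi.smul_apply, smul_eq_mul, Nat.cast_one,
    sub_self, zero_add, Fintype.card_unit, Nat.cast_one, zpow_one, ← s.root_add, hs, add_zero]
  cases τ ()
  · rw [hs, mul_zero, mul_zero]
  · rw [s.diff_eq, Bool.not_true, hs, sub_zero]

end Circle

section Empty

theorem algebraMap_invOf_two_mul_two (k L : Type) [CommRing k] [Invertible (2 : k)] [CommRing L]
    [Algebra k L] : algebraMap k L ⅟2 * 2 = 1 := by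
  rw [← map_ofNat (algebraMap k L) 2, ← map_mul, invOf_mul_self, map_one]

variable {k R L : Type} [CommRing k] [Invertible (2 : k)] [CommRing R] [CommRing L] [Algebra R L]
  [Algebra k L] {t : R} (s : Splitting L 0 t)

theorem diff_eq_two_mul_root (c : Bool) : (s.diff c : L) = 2 * s.root c := by
  have hadd : s.root true + s.root false = 0 := by rw [s.root_add, map_zero]
  rw [s.diff_eq]
  cases c
  · rw [Bool.not_false]
    linear_combination -hadd
  · rw [Bool.not_true]
    linear_combination -hadd

theorem transferMap_halfHandleDiscs [Nontrivial R] {S : Type} [Finite S] (κ : S → Fin 2) :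
    Surface.transferMap k s.diff_false (Surface.halfHandleDiscs k κ) (fun _ => 1)
      = s.evalTensor S (PiTensorProduct.tprod _ fun b => basis 0 t (κ b)) := by
  have := Fintype.ofFinite S
  funext τ
  rw [s.evalTensor_tprod_basis, Surface.halfHandleDiscs, map_smul, LinearMap.smul_apply,
    Surface.transferMap_toModRel, Pi.smul_apply, Surface.transfer_discs, one_mul,
    finsum_eq_sum_of_fintype, Algebra.smul_def, map_pow, ← Finset.prod_pow_eq_pow_sum,
    ← Finset.prod_mul_distrib]
  refine Fintype.prod_congr _ _ fun b => ?_
  rw [← mul_pow, s.diff_eq_two_mul_root, ← mul_assoc, algebraMap_invOf_two_mul_two, one_mul]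

theorem transferMap_connected_empty_three :
    Surface.transferMap k s.diff_false
        ((⅟2 : k) ^ 3 • Surface.toModRel k (Surface.connected (Empty ⊕ Empty) 3)) (fun _ => 1)
      = algebraMap R L t • fun _ => 1 := by
  have hroot (c : Bool) : s.root c * s.root c = algebraMap R L t := by
    rw [s.root_mul_root, map_zero, zero_mul, zero_add]
  have hdiff (c : Bool) : ((s.diff c ^ ((3 : ℕ) - 1 : ℤ) : Lˣ) : L) = 4 * algebraMap R L t := by
    rw [show ((3 : ℕ) - 1 : ℤ) = (2 : ℕ) by norm_num, zpow_natCast, Units.val_pow_eq_pow_val,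
      s.diff_eq_two_mul_root, ← hroot c]
    ring
  funext τ
  rw [map_smul, LinearMap.smul_apply, Surface.transferMap_toModRel, Pi.smul_apply, Pi.smul_apply,
    Surface.transfer_connected_of_isEmpty, Fintype.sum_bool, hdiff, hdiff, Algebra.smul_def,
    map_pow, smul_eq_mul, mul_one, mul_one]
  linear_combination algebraMap R L t * (congrArg (· ^ 3) (algebraMap_invOf_two_mul_two k L))

end Empty

end RankTwo.Splitting

namespace CobLoc

variable (k : Type) [CommRing k]

theorem generates_star (S : Cob) :
    Generates Cob.circle (handle k) S fun κ => Surface.toModRel k (Surface.star κ) :=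
  fun _ => Surface.eq_top_of_star

theorem exists_tqft_iso_circle [Nontrivial k] :
    ∃ F : TQFT (RankTwo.frobenius (Polynomial.X : Polynomial k) 0),
      Nonempty (fromCob k ⋙ tautological ((fromCob k).obj Cob.circle) (handle k) ≅ F.functor) :=
  let s := RankTwo.splittingOfRegular (Polynomial.X_mem_nonzeroDivisors (R := k))
  exists_tqft_iso Cob.circle s (IsFractionRing.injective _ _) (v := fun σ => s.root (σ ()))
    ((LinearMap.congr_fun (Surface.transferMap_toModRel ..) _).trans (s.transfer_handle_root rfl))
    (fun _ κ => Surface.toModRel k (Surface.star κ))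
    (fun _ κ => (LinearMap.congr_fun (Surface.transferMap_toModRel ..) _).trans
      (s.transfer_star_root rfl κ))
    (generates_star k)

/-- The renormalized 2-handle operator over a ring in which 2 is invertible: the disjoint union with
one eighth of the closed surface of genus 3. -/
def renormTwoHandleOver [Invertible (2 : k)] : End ((fromCob k).obj Cob.empty) :=
  (⅟2 : k) ^ 3 • (fromCob k).map (Cob.connected Cob.empty Cob.empty 3)

theorem generates_halfHandleDiscs [Invertible (2 : k)] (S : Cob) :
    Generates Cob.empty (renormTwoHandleOver k) S (Surface.halfHandleDiscs k) :=
  fun _ => Surface.eq_top_of_halfHandleDiscs ((isUnit_of_invertible _).pow 3)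

theorem exists_tqft_iso_empty [Nontrivial k] [Invertible (2 : k)] :
    ∃ F : TQFT (RankTwo.frobenius 0 (Polynomial.X : Polynomial k)),
      Nonempty (fromCob k ⋙ tautological ((fromCob k).obj Cob.empty) (renormTwoHandleOver k)
        ≅ F.functor) :=
  have : Invertible (2 : Polynomial k) :=
    (Invertible.map Polynomial.C (2 : k)).copy _ (map_ofNat Polynomial.C 2).symm
  let s := RankTwo.splittingTautological (Polynomial.X_mem_nonzeroDivisors (R := k))
  exists_tqft_iso Cob.empty s (RankTwo.algebraMap_fractionRing_injective _ _)
    s.transferMap_connected_empty_three (fun _ κ => Surface.halfHandleDiscs k κ)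
    (fun _ κ => s.transferMap_halfHandleDiscs κ) (generates_halfHandleDiscs k)

theorem renormTwoHandle_eq [Invertible (2 : ℚ)] : renormTwoHandle = renormTwoHandleOver ℚ := by
  rw [renormTwoHandle, twoHandle, renormTwoHandleOver, smul_smul, invOf_eq_inv]
  norm_num

end CobLoc

theorem mainTheorem11_general (k : Type) [CommRing k] [Nontrivial k] :
    (∃ F_H : TQFT (RankTwo.frobenius (Polynomial.X : Polynomial k) 0),
      Nonempty (CobLoc.fromCob k ⋙
        CobLoc.tautological ((CobLoc.fromCob k).obj Cob.circle) (CobLoc.handle k) ≅ F_H.functor)) ∧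
    ∀ [Invertible (2 : k)], ∃ F_T : TQFT (RankTwo.frobenius 0 (Polynomial.X : Polynomial k)),
      Nonempty (CobLoc.fromCob k ⋙
        CobLoc.tautological ((CobLoc.fromCob k).obj Cob.empty) (CobLoc.renormTwoHandleOver k)
          ≅ F_T.functor) :=
  ⟨CobLoc.exists_tqft_iso_circle k, CobLoc.exists_tqft_iso_empty k⟩

end

theorem mainTheorem11 :
    (∃ F_H : TQFT (RankTwo.frobenius (Polynomial.X : Polynomial ℤ) 0),
      Nonempty (CobLoc.fromCob ℤ ⋙
        CobLoc.tautological ((CobLoc.fromCob ℤ).obj Cob.circle) (CobLoc.handle ℤ) ≅ F_H.functor)) ∧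
    (∃ F_T : TQFT (RankTwo.frobenius 0 (Polynomial.X : Polynomial ℚ)),
      Nonempty (CobLoc.fromCob ℚ ⋙
        CobLoc.tautological ((CobLoc.fromCob ℚ).obj Cob.empty) CobLoc.renormTwoHandle
            ≅ F_T.functor)) := by
  have : Invertible (2 : ℚ) := invertibleOfNonzero two_ne_zero
  rw [CobLoc.renormTwoHandle_eq]
  exact ⟨(mainTheorem11_general ℤ).1, (mainTheorem11_general ℚ).2⟩
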